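/- Let $n\ge 0$ and let $H$ be the Hadamard gate. In the task $\mathbf{B}_{84}^{\times n}$, uniformly random bit strings $q,b\in\{0,1\}^n$ are chosen. Alice receives the $n$-qubit state $A_1=H^{q_1}|b_1\rangle\otimes\cdots\otimes H^{q_n}|b_n\rangle$ at the input point $c_1$ and the state $A_2=|q_1\rangle\otimes\cdots\otimes|q_n\rangle$ at the input point $c_2$. She succeeds if she returns $|b_1\rangle\otimes\cdots\otimes|b_n\rangle$ at both output points $r_1$ and $r_2$. No central region is available, and Alice's resource is a state (density matrix) $\rho_{R_1R_2}$ of two finite-dimensional quantum systems, with $R_1$ near $c_1$ and $R_2$ near $c_2$. Thus a protocol consists of - a quantum channel $A_1R_1\to M_{11}M_{12}$ near $c_1$ and a quantum channel $A_2R_2\to M_{21}M_{22}$ near $c_2$, where the messages $M_{ij}$ are arbitrary finite-dimensional quantum systems; - a single round of communication, in which $M_{11},M_{21}$ are sent to $r_1$ and $M_{12},M_{22}$ are sent to $r_2$; - a quantum channel $M_{11}M_{21}\to B_1$ at $r_1$ and a quantum channel $M_{12}M_{22}\to B_2$ at $r_2$, whose $n$-qubit outputs $B_1,B_2$ are compared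 with $|b_1\rangle\otimes\cdots\otimes|b_n\rangle$ by measurement in the computational basis. If some protocol completes $\mathbf{B}_{84}^{\times n}$ with success probability $1$ using the resource state $\rho_{R_1R_2}$, then $$\tfrac12\, I(R_1:R_2)\;\ge\; n\,\log_2\frac1\beta-1,\qquad \beta=\frac12+\frac1{2\sqrt2},$$ where $I(R_1:R_2)=S(\rho_{R_1})+S(\rho_{R_2})-S(\rho_{R_1R_2})$ is the quantum mutual information and $S(\rho)=-\mathrm{tr}(\rho\log_2\rho)$ is the von Neumann entropy in bits. -/

import Mathlib

open scoped Kronecker ComplexOrder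

noncomputable section

/-- A state of a finite-dimensional quantum system with orthonormal basis indexed by `d`:
a density matrix, i.e. a positive semidefinite complex matrix of trace one. -/
structure DensityMatrix (d : Type*) [Fintype d] where
  mat : Matrix d d ℂ
  posSemidef : mat.PosSemidef
  trace_eq_one : mat.trace = 1

/-- The partial trace over the second tensor factor. -/
def partialTraceSnd {a b : Type*} [Fintype b] (X : Matrix (a × b) (a × b) ℂ) : Matrix a a ℂ :=
  Matrix.of fun i j => ∑ k, X (i, k) (j, k)

/-- The partial trace over the first tensor factor. -/
def partialTraceFst {a b : Type*} [Fintype a] (X : Matrix (a × b) (a × b) ℂ) : Matrix b b ℂ :=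
  Matrix.of fun i j => ∑ k, X (k, i) (k, j)

theorem partialTraceSnd_posSemidef {a b : Type*} [Fintype a] [Fintype b]
    {X : Matrix (a × b) (a × b) ℂ} (hX : X.PosSemidef) : (partialTraceSnd X).PosSemidef := by
  have h : partialTraceSnd X = ∑ k : b, X.submatrix (fun i => (i, k)) (fun i => (i, k)) := by
    ext i j
    simp [partialTraceSnd, Matrix.sum_apply]
  rw [h]
  exact Matrix.posSemidef_sum _ fun k _ => hX.submatrix _

theorem partialTraceFst_posSemidef {a b : Type*} [Fintype a] [Fintype b]
    {X : Matrix (a × b) (a × b) ℂ} (hX : X.PosSemidef) : (partialTraceFst X).PosSemidef := by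
  have h : partialTraceFst X = ∑ k : a, X.submatrix (fun i => (k, i)) (fun i => (k, i)) := by
    ext i j
    simp [partialTraceFst, Matrix.sum_apply]
  rw [h]
  exact Matrix.posSemidef_sum _ fun k _ => hX.submatrix _

theorem trace_partialTraceSnd {a b : Type*} [Fintype a] [Fintype b]
    (X : Matrix (a × b) (a × b) ℂ) : (partialTraceSnd X).trace = X.trace := by
  simp [partialTraceSnd, Matrix.trace, Fintype.sum_prod_type]

theorem trace_partialTraceFst {a b : Type*} [Fintype a] [Fintype b]
    (X : Matrix (a × b) (a × b) ℂ) : (partialTraceFst X).trace = X.trace := by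
  simp [partialTraceFst, Matrix.trace, Fintype.sum_prod_type_right]

namespace DensityMatrix

/-- The reduced state on the first subsystem. -/
def marginalFst {a b : Type*} [Fintype a] [Fintype b] (ρ : DensityMatrix (a × b)) :
    DensityMatrix a where
  mat := partialTraceSnd ρ.mat
  posSemidef := partialTraceSnd_posSemidef ρ.posSemidef
  trace_eq_one := by rw [trace_partialTraceSnd, ρ.trace_eq_one]

/-- The reduced state on the second subsystem. -/
def marginalSnd {a b : Type*} [Fintype a] [Fintype b] (ρ : DensityMatrix (a × b)) :
    DensityMatrix b where
  mat := partialTraceFst ρ.mat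
  posSemidef := partialTraceFst_posSemidef ρ.posSemidef
  trace_eq_one := by rw [trace_partialTraceFst, ρ.trace_eq_one]

/-- The von Neumann entropy in bits, `S(ρ) = -∑ λ log₂ λ` over the eigenvalues `λ` of `ρ`,
with `0 log 0 = 0`. -/
def entropy {d : Type*} [Fintype d] [DecidableEq d] (ρ : DensityMatrix d) : ℝ :=
  -∑ i, ρ.posSemidef.isHermitian.eigenvalues i *
    Real.logb 2 (ρ.posSemidef.isHermitian.eigenvalues i)

/-- The mutual information in bits, `I(R₁:R₂) = S(R₁) + S(R₂) - S(R₁R₂)`. -/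
def mutualInformation {R₁ R₂ : Type*} [Fintype R₁] [DecidableEq R₁] [Fintype R₂] [DecidableEq R₂]
    (ρ : DensityMatrix (R₁ × R₂)) : ℝ :=
  ρ.marginalFst.entropy + ρ.marginalSnd.entropy - ρ.entropy

end DensityMatrix

/-- A quantum channel from the system with basis `a` to the system with basis `b`, given by
finitely many Kraus operators `K k` with `∑ (K k)ᴴ (K k) = 1`. -/
structure QChannel (a b : Type*) [Fintype a] [DecidableEq a] [Fintype b] where
  κ : Type
  [fintypeκ : Fintype κ]
  K : κ → Matrix b a ℂ
  complete : ∑ k, (K k).conjTranspose * K k = 1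

attribute [instance] QChannel.fintypeκ

namespace QChannel

/-- The action `X ↦ ∑ K X Kᴴ` of a channel. -/
def apply {a b : Type*} [Fintype a] [DecidableEq a] [Fintype b] (Φ : QChannel a b)
    (X : Matrix a a ℂ) : Matrix b b ℂ :=
  ∑ k, Φ.K k * X * (Φ.K k).conjTranspose

/-- The channel `Φ ⊗ Ψ` that acts with `Φ` on the first subsystem and independently with `Ψ` on
the second one. -/
def tensor {a b c d : Type*} [Fintype a] [DecidableEq a] [Fintype b] [Fintype c] [DecidableEq c]
    [Fintype d] (Φ : QChannel a b) (Ψ : QChannel c d) : QChannel (a × c) (b × d) where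
  κ := Φ.κ × Ψ.κ
  K := fun k => Φ.K k.1 ⊗ₖ Ψ.K k.2
  complete := by
    have h : ∀ k : Φ.κ × Ψ.κ, (Φ.K k.1 ⊗ₖ Ψ.K k.2).conjTranspose * (Φ.K k.1 ⊗ₖ Ψ.K k.2)
        = ((Φ.K k.1).conjTranspose * Φ.K k.1) ⊗ₖ ((Ψ.K k.2).conjTranspose * Ψ.K k.2) := by
      intro k
      rw [Matrix.conjTranspose_kronecker, Matrix.mul_kronecker_mul]
    simp only [h]
    rw [← Matrix.one_kronecker_one (m := a) (n := c), ← Φ.complete, ← Ψ.complete]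
    ext i j
    simp only [Matrix.sum_apply, Matrix.kroneckerMap_apply, Fintype.sum_prod_type,
      Finset.sum_mul_sum]

end QChannel

/-- Basis labels of a register of `n` qubits, equivalently bit strings of length `n`. -/
abbrev Bits (n : ℕ) : Type := Fin n → Fin 2

/-- The Hadamard matrix. -/
def hadamard : Matrix (Fin 2) (Fin 2) ℂ := ((1 / Real.sqrt 2 : ℝ) : ℂ) • !![1, 1; 1, -1]

/-- The vector `H^{q₁}|b₁⟩ ⊗ ⋯ ⊗ H^{qₙ}|bₙ⟩`. -/
def bb84Vec {n : ℕ} (q b : Bits n) : Bits n → ℂ :=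
  fun x => ∏ i, (hadamard ^ (q i : ℕ)) (x i) (b i)

/-- The rank one operator `|ψ⟩⟨ψ|`. -/
def ketbra {d : Type*} (ψ : d → ℂ) : Matrix d d ℂ := Matrix.vecMulVec ψ (star ψ)

/-- The basis vector `|x⟩`. -/
def ket {d : Type*} [DecidableEq d] (x : d) : d → ℂ := Pi.single x 1

/-- A strategy of Alice for the `n`-fold task without a central region.

Near `c₁` she acts on the input `A₁` and on the system `R₁` and gets a message `M₁₁` for `r₁` and a
message `M₁₂` for `r₂`. Near `c₂` she acts on the input `A₂` and on the system `R₂` and gets a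
message `M₂₁` for `r₁` and a message `M₂₂` for `r₂`. At `r₁` she turns `M₁₁M₂₁`, and at `r₂` she
turns `M₁₂M₂₂`, into an `n`-qubit output. All four operations are arbitrary quantum channels, and
the messages are quantum systems of arbitrary finite dimension. -/
structure B84Protocol (n : ℕ) (R₁ R₂ : Type*) [Fintype R₁] [DecidableEq R₁]
    [Fintype R₂] [DecidableEq R₂] where
  (m₁₁ m₁₂ m₂₁ m₂₂ : ℕ)
  atC₁ : QChannel (Bits n × R₁) (Fin m₁₁ × Fin m₁₂)
  atC₂ : QChannel (Bits n × R₂) (Fin m₂₁ × Fin m₂₂)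
  atR₁ : QChannel (Fin m₁₁ × Fin m₂₁) (Bits n)
  atR₂ : QChannel (Fin m₁₂ × Fin m₂₂) (Bits n)

namespace B84Protocol

/-- The state of the systems `(A₁R₁)(A₂R₂)` at the start: the inputs `A₁ = H^q|b⟩` and
`A₂ = |q⟩` next to the resource state `ρ` on `R₁R₂`. -/
def inputState {n : ℕ} {R₁ R₂ : Type*} [Fintype R₁] [Fintype R₂] (ρ : DensityMatrix (R₁ × R₂))
    (q b : Bits n) : Matrix ((Bits n × R₁) × (Bits n × R₂)) ((Bits n × R₁) × (Bits n × R₂)) ℂ :=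
  Matrix.reindex (Equiv.prodProdProdComm _ _ _ _) (Equiv.prodProdProdComm _ _ _ _)
    ((ketbra (bb84Vec q b) ⊗ₖ ketbra (ket q)) ⊗ₖ ρ.mat)

/-- The state of the outputs `B₁B₂` at the end. -/
def outputState {n : ℕ} {R₁ R₂ : Type*} [Fintype R₁] [DecidableEq R₁] [Fintype R₂]
    [DecidableEq R₂] (P : B84Protocol n R₁ R₂) (ρ : DensityMatrix (R₁ × R₂)) (q b : Bits n) :
    Matrix (Bits n × Bits n) (Bits n × Bits n) ℂ :=
  (P.atR₁.tensor P.atR₂).apply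
    (Matrix.reindex (Equiv.prodProdProdComm _ _ _ _) (Equiv.prodProdProdComm _ _ _ _)
      ((P.atC₁.tensor P.atC₂).apply (inputState ρ q b)))

/-- The probability that the outputs are `B₁ = B₂ = |b⟩`, when `q` and `b` are uniformly random. -/
def successProb {n : ℕ} {R₁ R₂ : Type*} [Fintype R₁] [DecidableEq R₁] [Fintype R₂]
    [DecidableEq R₂] (P : B84Protocol n R₁ R₂) (ρ : DensityMatrix (R₁ × R₂)) : ℝ :=
  (1 / 4 ^ n) * ∑ q : Bits n, ∑ b : Bits n, (P.outputState ρ q b (b, b) (b, b)).re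

end B84Protocol

/-- The resource state `ρ` suffices to complete the `n`-fold task with success probability `p`. -/
def SufficesForB84 {R₁ R₂ : Type*} [Fintype R₁] [DecidableEq R₁] [Fintype R₂] [DecidableEq R₂]
    (n : ℕ) (ρ : DensityMatrix (R₁ × R₂)) (p : ℝ) : Prop :=
  ∃ P : B84Protocol n R₁ R₂, P.successProb ρ = p

end

/-! Only the two basis strings q = 0…0 and q = 1…1 are needed. The channel near c₁ acts without
knowing q, so it must send enough about b towards r₁ if b is encoded in the computational basis, and
enough about b towards r₂ if b is encoded in the Hadamard basis. These bases are mutually unbiased,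
and the uncertainty relation with quantum memory gives H(X|M₁₁) + H(Z|M₁₂) ≥ n bits, where X and Z
are the uniform strings in the two encodings (`log_card_le_entropy_add_entropy`).

On the other hand, at r₁ the string is decoded perfectly from M₁₁ and M₂₁, and M₂₁ comes from R₂
alone once q is fixed. So M₂₁ makes up for all of H(X|M₁₁), and this cannot exceed the correlation
I(R₁:R₂) (`entropy_sub_le_of_decodable`); the same holds at r₂. Adding up, 2 I(R₁:R₂) ≥ n, that is ½
I ≥ n/4. Since log₂(1/β) < 1/4, this is more than the claim and does not need the term -1.

Both inequalities follow from monotonicity of relative entropy under channels (`IsRelEnt.kraus_le`).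
That rests on an integral representation: D(ρ‖σ) is obtained by integrating the quasi-entropies ⟨ρ,
(L_σ + t R_ρ)⁻¹ ρ⟩ over t > 0, up to a divergence that depends on tr ρ only. Each quasi-entropy is a
maximum of quadratic forms in X, and these are monotone by the Kadison–Schwarz inequality. -/

noncomputable section

open Matrix hiding hadamard
open Filter Topology

set_option linter.unusedSectionVars false

/-! ### Kraus maps, their duals and the Kadison–Schwarz inequality -/

section Kraus

variable {a b κ : Type*} [Fintype a] [Fintype b] [Fintype κ]

/-- The map `X ↦ ∑ K X Kᴴ` of a Kraus family. -/
def kraus (K : κ → Matrix b a ℂ) (X : Matrix a a ℂ) : Matrix b b ℂ :=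
  ∑ k, K k * X * (K k)ᴴ

/-- The adjoint map `Y ↦ ∑ Kᴴ Y K` of a Kraus family. -/
def krausDual (K : κ → Matrix b a ℂ) (Y : Matrix b b ℂ) : Matrix a a ℂ :=
  ∑ k, (K k)ᴴ * Y * K k

theorem trace_kraus_mul (K : κ → Matrix b a ℂ) (X : Matrix a a ℂ) (Y : Matrix b b ℂ) :
    (kraus K X * Y).trace = (X * krausDual K Y).trace := by
  simp only [kraus, krausDual, Finset.sum_mul, Finset.mul_sum, trace_sum]
  refine Finset.sum_congr rfl fun k _ => ?_
  rw [Matrix.mul_assoc, Matrix.mul_assoc, trace_mul_comm]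
  simp only [Matrix.mul_assoc]

theorem krausDual_conjTranspose {a b κ : Type*} [Fintype b] [Fintype κ]
    (K : κ → Matrix b a ℂ) (Y : Matrix b b ℂ) :
    krausDual K Yᴴ = (krausDual K Y)ᴴ := by
  simp [krausDual, conjTranspose_sum, Matrix.mul_assoc]

theorem kraus_posSemidef (K : κ → Matrix b a ℂ) {X : Matrix a a ℂ} (hX : X.PosSemidef) :
    (kraus K X).PosSemidef :=
  posSemidef_sum _ fun k _ => hX.mul_mul_conjTranspose_same (K k)

theorem trace_kraus [DecidableEq a] {K : κ → Matrix b a ℂ} (hK : ∑ k, (K k)ᴴ * K k = 1)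
    (X : Matrix a a ℂ) : (kraus K X).trace = X.trace := by
  classical
  have := trace_kraus_mul K X 1
  simpa [krausDual, hK] using this

/-- The Kadison–Schwarz inequality for a unital map given by Kraus operators. -/
theorem krausDual_schwarz [DecidableEq a] {K : κ → Matrix b a ℂ} (hK : ∑ k, (K k)ᴴ * K k = 1)
    (Y : Matrix b b ℂ) :
    (krausDual K (Y * Yᴴ) - krausDual K Y * (krausDual K Y)ᴴ).PosSemidef := by
  set Z := krausDual K Y with hZ
  -- The defect is a sum of squares: both cross terms sum to Z Zᴴ, and by completeness so does the
  -- last term.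
  have h : krausDual K (Y * Yᴴ) - Z * Zᴴ
      = ∑ k, ((K k)ᴴ * Y - Z * (K k)ᴴ) * ((K k)ᴴ * Y - Z * (K k)ᴴ)ᴴ := by
    have e : ∀ k, ((K k)ᴴ * Y - Z * (K k)ᴴ) * ((K k)ᴴ * Y - Z * (K k)ᴴ)ᴴ
        = (K k)ᴴ * (Y * Yᴴ) * K k - ((K k)ᴴ * Y * K k) * Zᴴ - Z * ((K k)ᴴ * Yᴴ * K k)
          + Z * ((K k)ᴴ * K k) * Zᴴ := by
      intro k
      simp only [conjTranspose_sub, conjTranspose_mul, conjTranspose_conjTranspose,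
        Matrix.mul_sub, Matrix.sub_mul, Matrix.mul_assoc]
      abel
    simp only [e, Finset.sum_add_distrib, Finset.sum_sub_distrib, ← Finset.mul_sum,
      ← Finset.sum_mul, hK]
    have h1 : ∑ k, (K k)ᴴ * Y * K k = Z := rfl
    have h2 : ∑ k, (K k)ᴴ * Yᴴ * K k = Zᴴ := by rw [hZ, ← krausDual_conjTranspose]; rfl
    rw [h1, h2]
    simp only [krausDual, Matrix.mul_one]
    abel
  rw [h]
  exact posSemidef_sum _ fun k _ => posSemidef_self_mul_conjTranspose _

end Kraus

/-- The von Neumann entropy in nats, as a function of the characteristic polynomial. -/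
def spectralEntropy {d : Type*} [Fintype d] [DecidableEq d] (A : Matrix d d ℂ) : ℝ :=
  (A.charpoly.roots.map fun z => Real.negMulLog z.re).sum

/-- `A = U diag(p) Uᴴ` with `U` unitary and `p ≥ 0`. -/
structure Diagonalizes {d : Type*} [Fintype d] [DecidableEq d] (A U : Matrix d d ℂ)
    (p : d → ℝ) : Prop where
  unitary : Uᴴ * U = 1
  nonneg : ∀ i, 0 ≤ p i
  eq : A = U * diagonal (fun i => (p i : ℂ)) * Uᴴ

/-! ### Diagonalization and entropy -/

section Spectral

variable {d : Type*} [Fintype d] [DecidableEq d]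

theorem Matrix.PosSemidef.exists_diagonalizes {A : Matrix d d ℂ} (hA : A.PosSemidef) :
    ∃ U p, Diagonalizes A U p := by
  refine ⟨hA.isHermitian.eigenvectorUnitary, hA.isHermitian.eigenvalues, ?_, ?_, ?_⟩
  · rw [← star_eq_conjTranspose]
    exact Unitary.coe_star_mul_self _
  · exact hA.eigenvalues_nonneg
  · conv_lhs => rw [hA.isHermitian.spectral_theorem]
    rw [Unitary.conjStarAlgAut_apply]
    rfl

theorem Matrix.PosSemidef.exists_eq_mul_conjTranspose {A : Matrix d d ℂ} (hA : A.PosSemidef) :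
    ∃ B : Matrix d d ℂ, A = B * Bᴴ := by
  obtain ⟨U, p, h⟩ := hA.exists_diagonalizes
  refine ⟨U * diagonal fun i => (√(p i) : ℂ), ?_⟩
  have : (diagonal fun i => (√(p i) : ℂ)) * (diagonal fun i => (√(p i) : ℂ))ᴴ
      = diagonal fun i => (p i : ℂ) := by
    rw [diagonal_conjTranspose, diagonal_mul_diagonal]
    congr 1
    ext i
    simp only [Pi.star_apply, Complex.star_def, Complex.conj_ofReal]
    rw [← Complex.ofReal_mul, Real.mul_self_sqrt (h.nonneg i)]
  rw [conjTranspose_mul, h.eq, ← this]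
  simp only [Matrix.mul_assoc]

theorem re_trace_mul_nonneg {A B : Matrix d d ℂ}
    (hA : A.PosSemidef) (hB : B.PosSemidef) : 0 ≤ (A * B).trace.re := by
  obtain ⟨C, rfl⟩ := hB.exists_eq_mul_conjTranspose
  have h : (A * (C * Cᴴ)).trace = (Cᴴ * A * C).trace := by
    rw [← Matrix.mul_assoc, trace_mul_comm, Matrix.mul_assoc]
  rw [h]
  exact (Complex.le_def.mp (hA.conjTranspose_mul_mul_same C).trace_nonneg).1

theorem spectralEntropy_diagonal (p : d → ℝ) :
    spectralEntropy (diagonal fun i => (p i : ℂ)) = ∑ i, Real.negMulLog (p i) := by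
  have h : ∏ i, (Polynomial.X - Polynomial.C (p i : ℂ))
      = ((Finset.univ.val.map fun i => (p i : ℂ)).map fun z => Polynomial.X - Polynomial.C z).prod := by
    rw [Multiset.map_map]; rfl
  rw [spectralEntropy, charpoly_diagonal, h, Polynomial.roots_multiset_prod_X_sub_C,
    Multiset.map_map]
  rfl

theorem Diagonalizes.mul_conjTranspose {A U : Matrix d d ℂ} {p : d → ℝ}
    (h : Diagonalizes A U p) : U * Uᴴ = 1 :=
  mul_eq_one_comm.mp h.unitary

theorem Diagonalizes.conj_eq {A U : Matrix d d ℂ} {p : d → ℝ}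
    (h : Diagonalizes A U p) : Uᴴ * A * U = diagonal fun i => (p i : ℂ) := by
  rw [h.eq, Matrix.mul_assoc, Matrix.mul_assoc, Matrix.mul_assoc, h.unitary, ← Matrix.mul_assoc,
    ← Matrix.mul_assoc, h.unitary]
  simp

/-- The characteristic polynomial is invariant under conjugation, so the entropy can be read off any
diagonalization. -/
theorem Diagonalizes.spectralEntropy_eq {A U : Matrix d d ℂ} {p : d → ℝ}
    (h : Diagonalizes A U p) : spectralEntropy A = ∑ i, Real.negMulLog (p i) := by
  rw [← spectralEntropy_diagonal, spectralEntropy, spectralEntropy]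
  have : A.charpoly = (diagonal fun i => (p i : ℂ)).charpoly := by
    rw [h.eq, charpoly_mul_comm, ← Matrix.mul_assoc, h.unitary, Matrix.one_mul]
  rw [this]

theorem Diagonalizes.re_trace {A U : Matrix d d ℂ} {p : d → ℝ}
    (h : Diagonalizes A U p) : A.trace.re = ∑ i, p i := by
  rw [h.eq, trace_mul_comm, ← Matrix.mul_assoc, h.unitary]
  simp [trace]

end Spectral

/-! ### Relative entropy and its monotonicity -/

section RelativeEntropy

variable {d : Type*} [Fintype d] [DecidableEq d]

/-- The concave quadratic form whose supremum over `X` is `⟨ρ, (L_σ + t R_ρ)⁻¹ ρ⟩`. -/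
def quasiForm (t : ℝ) (ρ σ X : Matrix d d ℂ) : ℝ :=
  2 * (ρ * X).trace.re - (σ * (X * Xᴴ)).trace.re - t * (ρ * (Xᴴ * X)).trace.re

/-- The quasi-entropy `⟨ρ, (L_σ + t R_ρ)⁻¹ ρ⟩` in terms of spectral data, where `v` is the
overlap matrix of the eigenbases. -/
def quasiEntropy {d : Type*} [Fintype d] (p s : d → ℝ) (v : Matrix d d ℂ) (t : ℝ) : ℝ :=
  ∑ j, ∑ i, Complex.normSq (v j i) * (p i ^ 2 / (s j + t * p i))

/-- In the coordinates x = Wᴴ X U the form decouples into scalar quadratics, one for each matrix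
entry. -/
theorem quasiForm_eq {ρ σ U W : Matrix d d ℂ} {p s : d → ℝ} (hρ : Diagonalizes ρ U p)
    (hσ : Diagonalizes σ W s) (t : ℝ) (X : Matrix d d ℂ) :
    quasiForm t ρ σ X = ∑ j, ∑ i, (2 * (p i * (star ((Wᴴ * U) j i) * (Wᴴ * X * U) j i).re)
      - (s j + t * p i) * Complex.normSq ((Wᴴ * X * U) j i)) := by
  have hUU := hρ.mul_conjTranspose
  have hWW := hσ.mul_conjTranspose
  set x := Wᴴ * X * U with hx
  set v := Wᴴ * U with hv
  have h1 : (ρ * X).trace = (diagonal (fun i => (p i : ℂ)) * (vᴴ * x)).trace := by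
    have : vᴴ * x = Uᴴ * X * U := by
      rw [hv, hx, conjTranspose_mul, conjTranspose_conjTranspose]
      calc Uᴴ * W * (Wᴴ * X * U) = Uᴴ * (W * Wᴴ) * X * U := by simp only [Matrix.mul_assoc]
        _ = _ := by rw [hWW, Matrix.mul_one]
    rw [this, hρ.eq, Matrix.mul_assoc, Matrix.mul_assoc, trace_mul_comm]
    simp only [Matrix.mul_assoc]
  have h2 : (σ * (X * Xᴴ)).trace = (diagonal (fun i => (s i : ℂ)) * (x * xᴴ)).trace := by
    have : x * xᴴ = Wᴴ * (X * Xᴴ) * W := by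
      rw [hx, conjTranspose_mul, conjTranspose_mul, conjTranspose_conjTranspose]
      calc Wᴴ * X * U * (Uᴴ * (Xᴴ * W)) = Wᴴ * X * (U * Uᴴ) * Xᴴ * W := by
            simp only [Matrix.mul_assoc]
        _ = _ := by rw [hUU, Matrix.mul_one]; simp only [Matrix.mul_assoc]
    rw [this, hσ.eq, Matrix.mul_assoc, Matrix.mul_assoc, trace_mul_comm]
    simp only [Matrix.mul_assoc]
  have h3 : (ρ * (Xᴴ * X)).trace = (diagonal (fun i => (p i : ℂ)) * (xᴴ * x)).trace := by
    have : xᴴ * x = Uᴴ * (Xᴴ * X) * U := by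
      rw [hx, conjTranspose_mul, conjTranspose_mul, conjTranspose_conjTranspose]
      calc Uᴴ * (Xᴴ * W) * (Wᴴ * X * U) = Uᴴ * Xᴴ * (W * Wᴴ) * X * U := by
            simp only [Matrix.mul_assoc]
        _ = _ := by rw [hWW, Matrix.mul_one]; simp only [Matrix.mul_assoc]
    rw [this, hρ.eq, Matrix.mul_assoc, Matrix.mul_assoc, trace_mul_comm]
    simp only [Matrix.mul_assoc]
  have e1 : (ρ * X).trace.re = ∑ j, ∑ i, p i * (star (v j i) * x j i).re := by
    rw [h1, Finset.sum_comm]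
    simp only [trace, diag_apply, diagonal_mul, mul_apply (N := x),
      conjTranspose_apply, Complex.re_sum,
      Complex.re_ofReal_mul, Finset.mul_sum]
  have e2 : (σ * (X * Xᴴ)).trace.re = ∑ j, ∑ i, s j * Complex.normSq (x j i) := by
    rw [h2]
    simp only [trace, diag_apply, diagonal_mul, mul_apply (N := xᴴ),
      conjTranspose_apply, Complex.re_sum,
      Complex.re_ofReal_mul, Finset.mul_sum, Complex.star_def, Complex.mul_conj, Complex.ofReal_re]
  have e3 : (ρ * (Xᴴ * X)).trace.re = ∑ j, ∑ i, p i * Complex.normSq (x j i) := by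
    rw [h3, Finset.sum_comm]
    simp only [trace, diag_apply, diagonal_mul, mul_apply (N := x),
      conjTranspose_apply, Complex.re_sum,
      Complex.re_ofReal_mul, Finset.mul_sum, Complex.star_def, ← Complex.normSq_eq_conj_mul_self,
      Complex.ofReal_re]
  rw [quasiForm, e1, e2, e3]
  simp only [Finset.mul_sum, ← Finset.sum_sub_distrib]
  refine Finset.sum_congr rfl fun j _ => Finset.sum_congr rfl fun i _ => ?_
  ring

/-- Completing the square entry by entry. Entries with p i = 0 are separate because s j + t * p i
may then vanish; there the bound is 0. -/
theorem quasiForm_le {ρ σ U W : Matrix d d ℂ} {p s : d → ℝ} (hρ : Diagonalizes ρ U p)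
    (hσ : Diagonalizes σ W s) {t : ℝ} (ht : 0 < t) (X : Matrix d d ℂ) :
    quasiForm t ρ σ X ≤ quasiEntropy p s (Wᴴ * U) t := by
  rw [quasiForm_eq hρ hσ]
  refine Finset.sum_le_sum fun j _ => Finset.sum_le_sum fun i _ => ?_
  generalize (Wᴴ * U) j i = v
  generalize (Wᴴ * X * U) j i = x
  have hp := hρ.nonneg i
  have hs := hσ.nonneg j
  rcases hp.eq_or_lt with h0 | h0
  · rw [← h0]
    have := mul_nonneg hs (Complex.normSq_nonneg x)
    simp
    linarith
  · have hc : 0 < s j + t * p i := by positivity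
    set c := s j + t * p i
    rw [← mul_div_assoc, le_div_iff₀ hc]
    simp only [Complex.normSq_apply, Complex.mul_re, Complex.star_def, Complex.conj_re,
      Complex.conj_im]
    nlinarith [sq_nonneg (c * x.re - p i * v.re), sq_nonneg (c * x.im - p i * v.im)]

theorem exists_quasiForm_eq {ρ σ U W : Matrix d d ℂ} {p s : d → ℝ} (hρ : Diagonalizes ρ U p)
    (hσ : Diagonalizes σ W s) {t : ℝ} (ht : 0 < t) :
    ∃ X, quasiForm t ρ σ X = quasiEntropy p s (Wᴴ * U) t := by
  -- The point where every completed square vanishes.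
  set x : Matrix d d ℂ := of fun j i => ((p i / (s j + t * p i) : ℝ) : ℂ) * (Wᴴ * U) j i with hx
  refine ⟨W * x * Uᴴ, ?_⟩
  have hX : Wᴴ * (W * x * Uᴴ) * U = x := by
    calc Wᴴ * (W * x * Uᴴ) * U = (Wᴴ * W) * x * (Uᴴ * U) := by simp only [Matrix.mul_assoc]
      _ = x := by rw [hσ.unitary, hρ.unitary, Matrix.one_mul, Matrix.mul_one]
  rw [quasiForm_eq hρ hσ, hX, quasiEntropy]
  refine Finset.sum_congr rfl fun j _ => Finset.sum_congr rfl fun i _ => ?_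
  simp only [hx, of_apply]
  generalize (Wᴴ * U) j i = v
  have hp := hρ.nonneg i
  have hs := hσ.nonneg j
  rw [map_mul, Complex.normSq_ofReal, mul_left_comm (star v), Complex.re_ofReal_mul, Complex.star_def,
    ← Complex.normSq_eq_conj_mul_self, Complex.ofReal_re]
  rcases hp.eq_or_lt with h0 | h0
  · rw [← h0]; simp
  · have hc : 0 < s j + t * p i := by positivity
    field_simp
    ring

/-- The linear term is carried over exactly by duality; the two quadratic terms are compared by
Kadison–Schwarz, applied to X and to Xᴴ. -/
theorem quasiForm_kraus_le {e κ : Type*} [Fintype e] [DecidableEq e] [Fintype κ]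
    {K : κ → Matrix e d ℂ} (hK : ∑ k, (K k)ᴴ * K k = 1) {ρ σ : Matrix d d ℂ}
    (hρ : ρ.PosSemidef) (hσ : σ.PosSemidef) {t : ℝ} (ht : 0 ≤ t) (X : Matrix e e ℂ) :
    quasiForm t (kraus K ρ) (kraus K σ) X ≤ quasiForm t ρ σ (krausDual K X) := by
  have h1 := re_trace_mul_nonneg hσ (krausDual_schwarz hK X)
  have h2 := re_trace_mul_nonneg hρ (krausDual_schwarz hK Xᴴ)
  rw [conjTranspose_conjTranspose, krausDual_conjTranspose, conjTranspose_conjTranspose] at h2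
  rw [Matrix.mul_sub, trace_sub, Complex.sub_re] at h1 h2
  simp only [quasiForm, trace_kraus_mul]
  nlinarith

/-- An explicit primitive in t of one summand of `quasiEntropy`, so that no integral has to be
formed. -/
theorem hasDerivAt_log_term {w p s : ℝ} (hp : 0 ≤ p) (hs : 0 ≤ s) {t : ℝ} (ht : 0 < t) :
    HasDerivAt (fun t => w * p * (Real.log (s + t * p) - Real.log s))
      (w * (p ^ 2 / (s + t * p))) t := by
  rcases hp.eq_or_lt with h0 | h0
  · subst h0
    simpa using hasDerivAt_const t (0 : ℝ)
  · have hc : s + t * p ≠ 0 := by positivity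
    have h := (((((hasDerivAt_id t).mul_const p).const_add s).log hc).sub_const
      (Real.log s)).const_mul (w * p)
    exact h.congr_deriv (by simp only [id, one_mul]; ring)

/-- The support condition matters at t = 0: for s = 0 the logarithm is singular there, but its
coefficient vanishes. -/
theorem continuousOn_log_term {w p s : ℝ} (hp : 0 ≤ p) (hs : 0 ≤ s) (h : s = 0 → w * p = 0) :
    ContinuousOn (fun t => w * p * (Real.log (s + t * p) - Real.log s)) (Set.Ici 0) := by
  rcases hs.eq_or_lt with h0 | h0
  · simp only [h h0.symm, zero_mul]
    exact continuousOn_const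
  · refine continuousOn_const.mul (ContinuousOn.sub (ContinuousOn.log (by fun_prop) ?_)
      continuousOn_const)
    intro t ht
    have : 0 ≤ t := ht
    positivity

/-- After removal of the divergent log t, the primitive tends to the corresponding summand of the
relative entropy. -/
theorem tendsto_log_term {w p s : ℝ} (hp : 0 ≤ p) :
    Tendsto (fun t => w * p * (Real.log (s + t * p) - Real.log s) - Real.log t * (w * p)) atTop
      (𝓝 (w * p * (Real.log p - Real.log s))) := by
  rcases hp.eq_or_lt with h0 | h0
  · subst h0; simp
  · have h1 : Tendsto (fun t : ℝ => s * t⁻¹ + p) atTop (𝓝 (s * 0 + p)) :=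
      (tendsto_inv_atTop_zero.const_mul s).add_const p
    rw [mul_zero, zero_add] at h1
    have h2 := (((h1.log h0.ne').sub_const (Real.log s)).const_mul (w * p))
    refine h2.congr' ?_
    have h3 : ∀ᶠ t : ℝ in atTop, 0 < s * t⁻¹ + p := h1.eventually (lt_mem_nhds h0)
    filter_upwards [eventually_gt_atTop 0, h3] with t ht h3
    have : s + t * p = t * (s * t⁻¹ + p) := by field_simp
    rw [this, Real.log_mul ht.ne' h3.ne']
    ring

/-- The relative entropy in terms of spectral data. -/
def spectralRelEnt {d : Type*} [Fintype d] (p s : d → ℝ) (v : Matrix d d ℂ) : ℝ :=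
  ∑ j, ∑ i, Complex.normSq (v j i) * p i * (Real.log (p i) - Real.log (s j))

/-- The difference of the two primitives vanishes at 0 and is monotone by `hq`. Its limit at
infinity is the difference of the relative entropies, because equal total weights make the log t
terms cancel. -/
theorem spectralRelEnt_le_of_quasiEntropy_le {d e : Type*} [Fintype d] [Fintype e]
    {p s : d → ℝ} {v : Matrix d d ℂ}
    {p' s' : e → ℝ} {v' : Matrix e e ℂ}
    (hp : ∀ i, 0 ≤ p i) (hs : ∀ i, 0 ≤ s i) (hp' : ∀ i, 0 ≤ p' i) (hs' : ∀ i, 0 ≤ s' i)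
    (h : ∀ j i, s j = 0 → Complex.normSq (v j i) * p i = 0)
    (h' : ∀ j i, s' j = 0 → Complex.normSq (v' j i) * p' i = 0)
    (hsum : ∑ j, ∑ i, Complex.normSq (v j i) * p i = ∑ j, ∑ i, Complex.normSq (v' j i) * p' i)
    (hq : ∀ t, 0 < t → quasiEntropy p' s' v' t ≤ quasiEntropy p s v t) :
    spectralRelEnt p' s' v' ≤ spectralRelEnt p s v := by
  let f : ℝ → ℝ := fun t =>
    ∑ j, ∑ i, Complex.normSq (v j i) * p i * (Real.log (s j + t * p i) - Real.log (s j))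
  let f' : ℝ → ℝ := fun t =>
    ∑ j, ∑ i, Complex.normSq (v' j i) * p' i * (Real.log (s' j + t * p' i) - Real.log (s' j))
  have hf : ∀ t, 0 < t → HasDerivAt f (quasiEntropy p s v t) t := fun t ht =>
    HasDerivAt.fun_sum fun j _ => HasDerivAt.fun_sum fun i _ =>
      hasDerivAt_log_term (hp i) (hs j) ht
  have hf' : ∀ t, 0 < t → HasDerivAt f' (quasiEntropy p' s' v' t) t := fun t ht =>
    HasDerivAt.fun_sum fun j _ => HasDerivAt.fun_sum fun i _ =>
      hasDerivAt_log_term (hp' i) (hs' j) ht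
  have hmono : MonotoneOn (fun t => f t - f' t) (Set.Ici 0) := by
    refine monotoneOn_of_deriv_nonneg (convex_Ici 0) ?_ ?_ ?_
    · refine ContinuousOn.sub ?_ ?_
      · exact continuousOn_finsetSum _ fun j _ => continuousOn_finsetSum _ fun i _ =>
          continuousOn_log_term (hp i) (hs j) (h j i)
      · exact continuousOn_finsetSum _ fun j _ => continuousOn_finsetSum _ fun i _ =>
          continuousOn_log_term (hp' i) (hs' j) (h' j i)
    · intro t ht
      rw [interior_Ici] at ht
      exact ((hf t ht).sub (hf' t ht)).differentiableAt.differentiableWithinAt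
    · intro t ht
      rw [interior_Ici] at ht
      rw [((hf t ht).fun_sub (hf' t ht)).deriv]
      exact sub_nonneg.mpr (hq t ht)
  have hzero : f 0 - f' 0 = 0 := by simp [f, f']
  have hlim : Tendsto (fun t => f t - f' t) atTop
      (𝓝 (spectralRelEnt p s v - spectralRelEnt p' s' v')) := by
    have l : Tendsto (fun t => f t - Real.log t * ∑ j, ∑ i, Complex.normSq (v j i) * p i) atTop
        (𝓝 (spectralRelEnt p s v)) := by
      simp only [f, Finset.mul_sum, ← Finset.sum_sub_distrib]
      exact tendsto_finsetSum _ fun j _ => tendsto_finsetSum _ fun i _ => tendsto_log_term (hp i)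
    have l' : Tendsto (fun t => f' t - Real.log t * ∑ j, ∑ i, Complex.normSq (v' j i) * p' i) atTop
        (𝓝 (spectralRelEnt p' s' v')) := by
      simp only [f', Finset.mul_sum, ← Finset.sum_sub_distrib]
      exact tendsto_finsetSum _ fun j _ => tendsto_finsetSum _ fun i _ => tendsto_log_term (hp' i)
    refine (l.sub l').congr fun t => ?_
    rw [hsum]
    ring
  refine sub_nonneg.mp (ge_of_tendsto hlim ?_)
  filter_upwards [eventually_ge_atTop 0] with t ht
  rw [← hzero]
  exact hmono (Set.mem_Ici.mpr le_rfl) ht ht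

/-- `r` is the relative entropy `D(ρ‖σ)`, computed in an eigenbasis of `σ`, and the support of `ρ`
lies in that of `σ`. -/
def IsRelEnt (ρ σ : Matrix d d ℂ) (r : ℝ) : Prop :=
  ∃ W s, Diagonalizes σ W s ∧ (∀ j, s j = 0 → ((Wᴴ * ρ * W) j j).re = 0) ∧
    r = -spectralEntropy ρ - ∑ j, ((Wᴴ * ρ * W) j j).re * Real.log (s j)

theorem Diagonalizes.conj_diag_re {ρ U : Matrix d d ℂ} {p : d → ℝ} (hρ : Diagonalizes ρ U p)
    (W : Matrix d d ℂ) (j : d) :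
    ((Wᴴ * ρ * W) j j).re = ∑ i, Complex.normSq ((Wᴴ * U) j i) * p i := by
  have : Wᴴ * ρ * W = (Wᴴ * U) * diagonal (fun i => (p i : ℂ)) * (Wᴴ * U)ᴴ := by
    rw [hρ.eq, conjTranspose_mul, conjTranspose_conjTranspose]
    simp only [Matrix.mul_assoc]
  rw [this, mul_apply, Complex.re_sum]
  refine Finset.sum_congr rfl fun i _ => ?_
  rw [mul_diagonal, conjTranspose_apply, mul_right_comm, Complex.star_def, Complex.mul_conj,
    ← Complex.ofReal_mul, Complex.ofReal_re]

theorem sum_normSq_eq_one {V : Matrix d d ℂ} (hV : Vᴴ * V = 1) (i : d) :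
    ∑ j, Complex.normSq (V j i) = 1 := by
  have h := congrFun (congrFun hV i) i
  simp only [mul_apply, conjTranspose_apply, Complex.star_def, ← Complex.normSq_eq_conj_mul_self,
    one_apply_eq] at h
  exact_mod_cast h

theorem unitary_overlap {ρ σ U W : Matrix d d ℂ} {p s : d → ℝ} (hρ : Diagonalizes ρ U p)
    (hσ : Diagonalizes σ W s) : (Wᴴ * U)ᴴ * (Wᴴ * U) = 1 := by
  rw [conjTranspose_mul, conjTranspose_conjTranspose]
  calc Uᴴ * W * (Wᴴ * U) = Uᴴ * (W * Wᴴ) * U := by simp only [Matrix.mul_assoc]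
    _ = 1 := by rw [hσ.mul_conjTranspose, Matrix.mul_one, hρ.unitary]

/-- The overlap matrix is unitary, so its squared moduli sum to one over j and the log (p i) terms
collapse to the entropy of ρ. -/
theorem spectralRelEnt_eq {ρ σ U W : Matrix d d ℂ} {p s : d → ℝ} (hρ : Diagonalizes ρ U p)
    (hσ : Diagonalizes σ W s) :
    spectralRelEnt p s (Wᴴ * U)
      = -spectralEntropy ρ - ∑ j, ((Wᴴ * ρ * W) j j).re * Real.log (s j) := by
  rw [hρ.spectralEntropy_eq]
  simp only [hρ.conj_diag_re W, Finset.sum_mul, spectralRelEnt, mul_sub, Finset.sum_sub_distrib]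
  congr 1
  rw [Finset.sum_comm, ← Finset.sum_neg_distrib]
  refine Finset.sum_congr rfl fun i _ => ?_
  simp only [mul_assoc]
  rw [← Finset.sum_mul, sum_normSq_eq_one (unitary_overlap hρ hσ)]
  simp [Real.negMulLog]

theorem Diagonalizes.posSemidef {A U : Matrix d d ℂ} {p : d → ℝ} (h : Diagonalizes A U p) :
    A.PosSemidef := by
  rw [h.eq]
  exact (posSemidef_diagonal_iff.mpr fun i => by exact_mod_cast h.nonneg i)
    |>.mul_mul_conjTranspose_same U

theorem support_overlap {ρ U W : Matrix d d ℂ} {p s : d → ℝ} (hρ : Diagonalizes ρ U p)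
    (hsupp : ∀ j, s j = 0 → ((Wᴴ * ρ * W) j j).re = 0) (j i : d) (hj : s j = 0) :
    Complex.normSq ((Wᴴ * U) j i) * p i = 0 := by
  have h := hsupp j hj
  rw [hρ.conj_diag_re W, Finset.sum_eq_zero_iff_of_nonneg
    fun i _ => mul_nonneg (Complex.normSq_nonneg _) (hρ.nonneg i)] at h
  exact h i (Finset.mem_univ _)

theorem sum_overlap {ρ σ U W : Matrix d d ℂ} {p s : d → ℝ} (hρ : Diagonalizes ρ U p)
    (hσ : Diagonalizes σ W s) :
    ∑ j, ∑ i, Complex.normSq ((Wᴴ * U) j i) * p i = ρ.trace.re := by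
  rw [Finset.sum_comm, hρ.re_trace]
  refine Finset.sum_congr rfl fun i _ => ?_
  rw [← Finset.sum_mul, sum_normSq_eq_one (unitary_overlap hρ hσ), one_mul]

/-- Monotonicity of the relative entropy under quantum channels. -/
theorem IsRelEnt.kraus_le {e κ : Type*} [Fintype e] [DecidableEq e] [Fintype κ]
    {K : κ → Matrix e d ℂ} (hK : ∑ k, (K k)ᴴ * K k = 1) {ρ σ : Matrix d d ℂ}
    (hρ : ρ.PosSemidef) {r r' : ℝ} (hr : IsRelEnt ρ σ r)
    (hr' : IsRelEnt (kraus K ρ) (kraus K σ) r') : r' ≤ r := by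
  obtain ⟨W, s, hσ, hsupp, rfl⟩ := hr
  obtain ⟨W', s', hσ', hsupp', rfl⟩ := hr'
  obtain ⟨U, p, hU⟩ := hρ.exists_diagonalizes
  obtain ⟨U', p', hU'⟩ := (kraus_posSemidef K hρ).exists_diagonalizes
  rw [← spectralRelEnt_eq hU hσ, ← spectralRelEnt_eq hU' hσ']
  refine spectralRelEnt_le_of_quasiEntropy_le hU.nonneg hσ.nonneg hU'.nonneg hσ'.nonneg
    (support_overlap hU hsupp) (support_overlap hU' hsupp') ?_ ?_
  · rw [sum_overlap hU hσ, sum_overlap hU' hσ', trace_kraus hK]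
  · intro t ht
    -- The optimal X for the output pair, pulled back by the dual map, is a competitor for the input
    -- pair.
    obtain ⟨X, hX⟩ := exists_quasiForm_eq hU' hσ' ht
    rw [← hX]
    exact (quasiForm_kraus_le hK hρ hσ.posSemidef ht.le X).trans (quasiForm_le hU hσ ht _)

end RelativeEntropy

/-! ### Entropy and mutual information of bipartite systems -/

section Entropy

variable {a b : Type*} [Fintype a] [Fintype b] [DecidableEq a] [DecidableEq b]

/-- AB and BA have the same nonzero spectrum, and the eigenvalue 0 contributes nothing. This is what
equates entropies of complementary parts of a pure state. -/
theorem spectralEntropy_mul_comm (A : Matrix a b ℂ) (B : Matrix b a ℂ) :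
    spectralEntropy (A * B) = spectralEntropy (B * A) := by
  have h := congrArg Polynomial.roots (charpoly_mul_comm' A B)
  have hX : ∀ n, (Polynomial.X : Polynomial ℂ) ^ n ≠ 0 := fun n => pow_ne_zero n Polynomial.X_ne_zero
  rw [Polynomial.roots_mul (mul_ne_zero (hX _) (charpoly_monic _).ne_zero),
    Polynomial.roots_mul (mul_ne_zero (hX _) (charpoly_monic _).ne_zero)] at h
  have h' := congrArg (fun m : Multiset ℂ => (m.map fun z => Real.negMulLog z.re).sum) h
  simpa [spectralEntropy, Multiset.map_nsmul, Multiset.sum_nsmul] using h'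

theorem spectralEntropy_submatrix_equiv (e : a ≃ b) (A : Matrix b b ℂ) :
    spectralEntropy (A.submatrix e e) = spectralEntropy A := by
  rw [spectralEntropy, spectralEntropy]
  have := charpoly_reindex e.symm A
  rw [reindex_apply, Equiv.symm_symm] at this
  rw [this]

/-- The mutual information in nats of a matrix on a bipartite system. -/
def matrixMutualInfo (X : Matrix (a × b) (a × b) ℂ) : ℝ :=
  spectralEntropy (partialTraceSnd X) + spectralEntropy (partialTraceFst X) - spectralEntropy X

theorem trace_partialTraceSnd_mul {a b : Type*} [Fintype a] [Fintype b] [DecidableEq b]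
    (X : Matrix (a × b) (a × b) ℂ) (Y : Matrix a a ℂ) :
    (partialTraceSnd X * Y).trace = (X * (Y ⊗ₖ (1 : Matrix b b ℂ))).trace := by
  simp only [trace, diag_apply, mul_apply, partialTraceSnd, of_apply, kroneckerMap_apply,
    Fintype.sum_prod_type, Finset.sum_mul, one_apply, mul_ite, mul_one, mul_zero,
    Finset.sum_ite_eq', Finset.mem_univ, if_true]
  refine Finset.sum_congr rfl fun i _ => ?_
  rw [Finset.sum_comm]

theorem trace_partialTraceFst_mul {a b : Type*} [Fintype a] [Fintype b] [DecidableEq a]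
    (X : Matrix (a × b) (a × b) ℂ) (Y : Matrix b b ℂ) :
    (partialTraceFst X * Y).trace = (X * ((1 : Matrix a a ℂ) ⊗ₖ Y)).trace := by
  simp only [trace, diag_apply, mul_apply, partialTraceFst, of_apply, kroneckerMap_apply,
    Fintype.sum_prod_type_right, Finset.sum_mul, one_apply, ite_mul, one_mul, zero_mul, mul_ite,
    mul_zero, Finset.sum_ite_eq', Finset.mem_univ, if_true]
  refine Finset.sum_congr rfl fun i _ => ?_
  rw [Finset.sum_comm]

theorem Diagonalizes.kronecker {A U : Matrix a a ℂ} {p : a → ℝ} {B V : Matrix b b ℂ} {q : b → ℝ}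
    (hA : Diagonalizes A U p) (hB : Diagonalizes B V q) :
    Diagonalizes (A ⊗ₖ B) (U ⊗ₖ V) (fun i => p i.1 * q i.2) where
  unitary := by
    rw [conjTranspose_kronecker, ← mul_kronecker_mul, hA.unitary, hB.unitary, one_kronecker_one]
  nonneg i := mul_nonneg (hA.nonneg _) (hB.nonneg _)
  eq := by
    have : (diagonal fun i : a × b => ((p i.1 * q i.2 : ℝ) : ℂ))
        = (diagonal fun i => (p i : ℂ)) ⊗ₖ (diagonal fun i => (q i : ℂ)) := by
      rw [diagonal_kronecker_diagonal]
      simp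
    rw [this, conjTranspose_kronecker, ← mul_kronecker_mul, ← mul_kronecker_mul, ← hA.eq, ← hB.eq]

/-! ### Local channels and partial traces -/

section Kraus

variable {c d κ l : Type*} [Fintype c] [Fintype d] [Fintype κ] [Fintype l]

/-- The Kraus family of the tensor product of two maps. -/
def krausTensor {a b c d κ l : Type*} (K : κ → Matrix c a ℂ) (L : l → Matrix d b ℂ)
    (k : κ × l) : Matrix (c × d) (a × b) ℂ :=
  K k.1 ⊗ₖ L k.2

theorem sum_kronecker_sum {a b c d κ l : Type*} [Fintype κ] [Fintype l]
    (A : κ → Matrix a c ℂ) (B : l → Matrix b d ℂ) :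
    ∑ k : κ × l, A k.1 ⊗ₖ B k.2 = (∑ k, A k) ⊗ₖ (∑ k, B k) := by
  ext i j
  simp only [Matrix.sum_apply, kroneckerMap_apply, Fintype.sum_prod_type, Finset.sum_mul_sum]

theorem krausDual_krausTensor {a b : Type*}
    (K : κ → Matrix c a ℂ) (L : l → Matrix d b ℂ) (Y : Matrix c c ℂ)
    (Z : Matrix d d ℂ) :
    krausDual (krausTensor K L) (Y ⊗ₖ Z) = krausDual K Y ⊗ₖ krausDual L Z := by
  simp only [krausDual, krausTensor, conjTranspose_kronecker, ← mul_kronecker_mul]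
  exact sum_kronecker_sum (fun k => (K k)ᴴ * Y * K k) (fun k => (L k)ᴴ * Z * L k)

theorem kraus_krausTensor {a b c d : Type*} [Fintype a] [Fintype b]
    (K : κ → Matrix c a ℂ) (L : l → Matrix d b ℂ) (Y : Matrix a a ℂ)
    (Z : Matrix b b ℂ) :
    kraus (krausTensor K L) (Y ⊗ₖ Z) = kraus K Y ⊗ₖ kraus L Z := by
  simp only [kraus, krausTensor, conjTranspose_kronecker, ← mul_kronecker_mul]
  exact sum_kronecker_sum (fun k => K k * Y * (K k)ᴴ) (fun k => L k * Z * (L k)ᴴ)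

theorem sum_krausTensor {a b : Type*} [DecidableEq a] [DecidableEq b]
    {K : κ → Matrix c a ℂ} {L : l → Matrix d b ℂ}
    (hK : ∑ k, (K k)ᴴ * K k = 1) (hL : ∑ k, (L k)ᴴ * L k = 1) :
    ∑ k, (krausTensor K L k)ᴴ * krausTensor K L k = 1 := by
  simp only [krausTensor, conjTranspose_kronecker, ← mul_kronecker_mul]
  rw [sum_kronecker_sum (fun k => (K k)ᴴ * K k) (fun k => (L k)ᴴ * L k), hK, hL, one_kronecker_one]

/-- Tested against all Y ⊗ 1: the dual of a trace-preserving map fixes 1, so its action on the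
discarded system is invisible. -/
theorem partialTraceSnd_kraus {a b : Type*} [Fintype a] [Fintype b] [DecidableEq b]
    (K : κ → Matrix c a ℂ) {L : l → Matrix d b ℂ}
    (hL : ∑ k, (L k)ᴴ * L k = 1) (X : Matrix (a × b) (a × b) ℂ) :
    partialTraceSnd (kraus (krausTensor K L) X) = kraus K (partialTraceSnd X) := by
  classical
  refine ext_iff_trace_mul_right.mpr fun Y => ?_
  rw [trace_partialTraceSnd_mul, trace_kraus_mul, trace_kraus_mul, trace_partialTraceSnd_mul,
    krausDual_krausTensor]
  simp [krausDual, hL]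

theorem partialTraceFst_kraus {a b : Type*} [Fintype a] [Fintype b] [DecidableEq a]
    {K : κ → Matrix c a ℂ} (hK : ∑ k, (K k)ᴴ * K k = 1)
    (L : l → Matrix d b ℂ) (X : Matrix (a × b) (a × b) ℂ) :
    partialTraceFst (kraus (krausTensor K L) X) = kraus L (partialTraceFst X) := by
  classical
  refine ext_iff_trace_mul_right.mpr fun Y => ?_
  rw [trace_partialTraceFst_mul, trace_kraus_mul, trace_kraus_mul, trace_partialTraceFst_mul,
    krausDual_krausTensor]
  simp [krausDual, hK]

end Kraus

/-! ### Mutual information as a relative entropy -/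

section MutualInfo

theorem partialTrace_conj_kronecker {U : Matrix a a ℂ} {V : Matrix b b ℂ} (hU : U * Uᴴ = 1)
    (hV : V * Vᴴ = 1) (X : Matrix (a × b) (a × b) ℂ) :
    partialTraceSnd ((U ⊗ₖ V)ᴴ * X * (U ⊗ₖ V)) = Uᴴ * partialTraceSnd X * U ∧
    partialTraceFst ((U ⊗ₖ V)ᴴ * X * (U ⊗ₖ V)) = Vᴴ * partialTraceFst X * V := by
  have h : (U ⊗ₖ V)ᴴ * X * (U ⊗ₖ V)
      = kraus (krausTensor (fun _ : Unit => Uᴴ) (fun _ : Unit => Vᴴ)) X := by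
    simp [kraus, krausTensor, conjTranspose_kronecker]
  rw [h, partialTraceSnd_kraus _ (by simpa using hV), partialTraceFst_kraus (by simpa using hU)]
  simp [kraus]

/-- In the product of eigenbases of the marginals, the diagonal of X is a joint distribution with
marginals p and q, and log (p q) splits into two marginal sums. -/
theorem isRelEnt_marginals {X : Matrix (a × b) (a × b) ℂ} (hX : X.PosSemidef) :
    IsRelEnt X (partialTraceSnd X ⊗ₖ partialTraceFst X) (matrixMutualInfo X) := by
  obtain ⟨U, p, hp⟩ := (partialTraceSnd_posSemidef hX).exists_diagonalizes
  obtain ⟨V, q, hq⟩ := (partialTraceFst_posSemidef hX).exists_diagonalizes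
  set T := (U ⊗ₖ V)ᴴ * X * (U ⊗ₖ V) with hT
  obtain ⟨h1, h2⟩ := partialTrace_conj_kronecker hp.mul_conjTranspose hq.mul_conjTranspose X
  rw [hp.conj_eq] at h1
  rw [hq.conj_eq] at h2
  have hnn : ∀ i, 0 ≤ (T i i).re := fun i =>
    (Complex.le_def.mp ((hX.conjTranspose_mul_mul_same (U ⊗ₖ V)).diag_nonneg (i := i))).1
  have hp' : ∀ i, ∑ k, (T (i, k) (i, k)).re = p i := fun i => by
    have := congrArg Complex.re (congrFun (congrFun h1 i) i)
    simpa [partialTraceSnd] using this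
  have hq' : ∀ k, ∑ i, (T (i, k) (i, k)).re = q k := fun i => by
    have := congrArg Complex.re (congrFun (congrFun h2 i) i)
    simpa [partialTraceFst] using this
  have zp : ∀ i k, p i = 0 → (T (i, k) (i, k)).re = 0 := fun i k h => by
    rw [← hp', Finset.sum_eq_zero_iff_of_nonneg fun k _ => hnn (i, k)] at h
    exact h k (Finset.mem_univ _)
  have zq : ∀ i k, q k = 0 → (T (i, k) (i, k)).re = 0 := fun i k h => by
    rw [← hq', Finset.sum_eq_zero_iff_of_nonneg fun i _ => hnn (i, k)] at h
    exact h i (Finset.mem_univ _)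
  refine ⟨U ⊗ₖ V, _, hp.kronecker hq, ?_, ?_⟩
  · rintro ⟨i, k⟩ h
    rcases mul_eq_zero.mp h with h | h
    exacts [zp i k h, zq i k h]
  · rw [← hT, matrixMutualInfo, hp.spectralEntropy_eq, hq.spectralEntropy_eq]
    have e : ∀ j : a × b, (T j j).re * Real.log (p j.1 * q j.2)
        = (T j j).re * Real.log (p j.1) + (T j j).re * Real.log (q j.2) := by
      rintro ⟨i, k⟩
      -- The logarithm splits only for nonzero factors; a zero marginal forces the joint weight to
      -- vanish.
      by_cases h : p i = 0
      · simp [zp i k h]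
      by_cases h' : q k = 0
      · simp [zq i k h']
      rw [Real.log_mul h h', mul_add]
    simp only [e, Finset.sum_add_distrib]
    have e1 : ∑ j : a × b, (T j j).re * Real.log (p j.1) = -∑ i, Real.negMulLog (p i) := by
      simp only [Fintype.sum_prod_type, ← Finset.sum_mul, hp', Real.negMulLog, neg_mul,
        Finset.sum_neg_distrib, neg_neg]
    have e2 : ∑ j : a × b, (T j j).re * Real.log (q j.2) = -∑ i, Real.negMulLog (q i) := by
      simp only [Fintype.sum_prod_type_right, ← Finset.sum_mul, hq', Real.negMulLog, neg_mul,
        Finset.sum_neg_distrib, neg_neg]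
    rw [e1, e2]
    ring

/-- Monotonicity of the mutual information under local channels. -/
theorem matrixMutualInfo_krausTensor_le {c d κ l : Type*} [Fintype c] [Fintype d] [DecidableEq c]
    [DecidableEq d] [Fintype κ] [Fintype l] {K : κ → Matrix c a ℂ} {L : l → Matrix d b ℂ}
    (hK : ∑ k, (K k)ᴴ * K k = 1) (hL : ∑ k, (L k)ᴴ * L k = 1)
    {X : Matrix (a × b) (a × b) ℂ} (hX : X.PosSemidef) :
    matrixMutualInfo (kraus (krausTensor K L) X) ≤ matrixMutualInfo X := by
  have h := isRelEnt_marginals (kraus_posSemidef (krausTensor K L) hX)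
  -- A product channel maps the product of the marginals to the product of the output marginals, so
  -- monotonicity applies to this pair.
  rw [partialTraceSnd_kraus K hL, partialTraceFst_kraus hK, ← kraus_krausTensor] at h
  exact (isRelEnt_marginals hX).kraus_le (sum_krausTensor hK hL) hX h

theorem sum_single_conjTranspose_mul_single :
    ∑ i, (Matrix.single () i (1 : ℂ))ᴴ * Matrix.single () i (1 : ℂ) = (1 : Matrix a a ℂ) := by
  simp only [conjTranspose_single, single_mul_single_same, star_one, one_mul]
  ext i j
  simp [Matrix.sum_apply, single_apply, one_apply, ite_and]

theorem spectralEntropy_eq_zero_of_unique [Subsingleton a] {A : Matrix a a ℂ} (hA : A.trace = 1) :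
    spectralEntropy A = 0 := by
  have : A = diagonal fun _ => ((1 : ℝ) : ℂ) := by
    ext i j
    rw [Subsingleton.elim i j, diagonal_apply_eq, Complex.ofReal_one, ← hA]
    simp [trace, Fintype.sum_subsingleton _ j]
  rw [this, spectralEntropy_diagonal]
  simp

/-- Subadditivity of the entropy. -/
theorem matrixMutualInfo_nonneg {X : Matrix (a × b) (a × b) ℂ} (hX : X.PosSemidef)
    (htr : X.trace = 1) : 0 ≤ matrixMutualInfo X := by
  have hK := sum_single_conjTranspose_mul_single (a := a)
  have hL := sum_single_conjTranspose_mul_single (a := b)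
  -- Tracing out both sides is a local channel to one-dimensional systems, where the mutual
  -- information is 0.
  refine le_trans (le_of_eq ?_) (matrixMutualInfo_krausTensor_le hK hL hX)
  have h := trace_kraus (sum_krausTensor hK hL) X
  rw [htr] at h
  rw [matrixMutualInfo, spectralEntropy_eq_zero_of_unique h,
    spectralEntropy_eq_zero_of_unique ((trace_partialTraceSnd _).trans h),
    spectralEntropy_eq_zero_of_unique ((trace_partialTraceFst _).trans h)]
  norm_num

/-- The relative entropy with respect to a pinching. -/
theorem isRelEnt_blockDiagonal {ρ : Matrix (a × b) (a × b) ℂ} {τ : b → Matrix a a ℂ}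
    (hτ : ∀ x, (τ x).PosSemidef) (h : ∀ x i j, ρ (i, x) (j, x) = τ x i j) :
    IsRelEnt ρ (blockDiagonal τ) (spectralEntropy (blockDiagonal τ) - spectralEntropy ρ) := by
  -- A block-diagonal eigenbasis of the pinched matrix sees only the diagonal blocks of ρ, where the
  -- two matrices agree.
  choose U p hU using fun x => (hτ x).exists_diagonalizes
  have hD : Diagonalizes (blockDiagonal τ) (blockDiagonal U) (fun i => p i.2 i.1) := by
    refine ⟨?_, fun i => (hU i.2).nonneg _, ?_⟩
    · rw [blockDiagonal_conjTranspose, ← blockDiagonal_mul]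
      simp only [(hU _).unitary]
      exact blockDiagonal_one
    · have : (diagonal fun i : a × b => (p i.2 i.1 : ℂ))
          = blockDiagonal fun x => diagonal fun i => (p x i : ℂ) := by
        rw [blockDiagonal_diagonal]
      rw [this, blockDiagonal_conjTranspose, ← blockDiagonal_mul, ← blockDiagonal_mul]
      exact congrArg _ (funext fun x => (hU x).eq)
  have hd : ∀ i, (((blockDiagonal U)ᴴ * ρ * blockDiagonal U) i i).re = p i.2 i.1 := by
    rintro ⟨i, x⟩
    have e : ((blockDiagonal U)ᴴ * ρ * blockDiagonal U) (i, x) (i, x)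
        = ((U x)ᴴ * τ x * U x) i i := by
      simp only [mul_apply, conjTranspose_apply, blockDiagonal_apply, Fintype.sum_prod_type, ← h,
        mul_ite, apply_ite star, ite_mul, star_zero, zero_mul, mul_zero,
        Finset.sum_ite_eq', Finset.mem_univ, if_true]
    rw [e, (hU x).conj_eq]
    simp
  refine ⟨_, _, hD, fun i hi => by rw [hd, hi], ?_⟩
  simp only [hd]
  rw [hD.spectralEntropy_eq]
  simp only [Real.negMulLog, neg_mul, Finset.sum_neg_distrib]
  ring

end MutualInfo

end Entropy

/-! ### Uniform and perfectly correlated classical registers -/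

section Uniform

variable {X : Type*} [Fintype X] [DecidableEq X]

theorem spectralEntropy_transpose (A : Matrix X X ℂ) : spectralEntropy Aᵀ = spectralEntropy A := by
  rw [spectralEntropy, charpoly_transpose, spectralEntropy]

theorem spectralEntropy_smul_one [Nonempty X] :
    spectralEntropy ((Fintype.card X : ℂ)⁻¹ • (1 : Matrix X X ℂ)) = Real.log (Fintype.card X) := by
  have : (Fintype.card X : ℂ)⁻¹ • (1 : Matrix X X ℂ)
      = diagonal fun _ => (((Fintype.card X : ℝ)⁻¹ : ℝ) : ℂ) := by
    rw [smul_one_eq_diagonal]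
    simp
  rw [this, spectralEntropy_diagonal]
  have h : (Fintype.card X : ℝ) ≠ 0 := by simp
  simp [Real.negMulLog]

/-- A perfectly correlated uniform pair has mutual information `log d`. -/
theorem matrixMutualInfo_correlated [Nonempty X] :
    matrixMutualInfo (blockDiagonal fun x : X => Matrix.single x x (Fintype.card X : ℂ)⁻¹)
      = Real.log (Fintype.card X) := by
  set w := (Fintype.card X : ℂ)⁻¹ with hw
  have e : ∀ i x j y : X, (blockDiagonal fun x : X => Matrix.single x x w) (i, x) (j, y)
      = if x = y ∧ i = x ∧ j = x then w else 0 := by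
    intro i x j y
    simp only [blockDiagonal_apply, single_apply, ite_and, eq_comm]
  have h0 : (blockDiagonal fun x : X => Matrix.single x x w)
      = diagonal fun i : X × X =>
        ((if i.1 = i.2 then (Fintype.card X : ℝ)⁻¹ else 0 : ℝ) : ℂ) := by
    ext ⟨i, x⟩ ⟨j, y⟩
    rw [e, diagonal_apply]
    by_cases h : i = x
    · subst h
      by_cases h' : i = y <;> by_cases h'' : j = i <;> simp_all [eq_comm]
    · simp [h]
  have h1 : partialTraceSnd (blockDiagonal fun x : X => Matrix.single x x w) = w • 1 := by
    ext i j
    simp only [partialTraceSnd, of_apply, e, Matrix.smul_apply, one_apply, smul_eq_mul, mul_ite,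
      mul_one, mul_zero, true_and, ite_and, Finset.sum_ite_eq, Finset.mem_univ, if_true]
    simp only [eq_comm]
  have h2 : partialTraceFst (blockDiagonal fun x : X => Matrix.single x x w) = w • 1 := by
    ext i j
    simp only [partialTraceFst, of_apply, e, Matrix.smul_apply, one_apply, smul_eq_mul, mul_ite,
      mul_one, mul_zero]
    by_cases h : i = j
    · subst h; simp
    · simp [h]
  have hc : (Fintype.card X : ℝ) ≠ 0 := by simp
  rw [matrixMutualInfo, h1, h2, h0, spectralEntropy_diagonal, hw, spectralEntropy_smul_one,
    Fintype.sum_prod_type]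
  simp [Real.negMulLog]

/-- The other diagonal entries are nonnegative with sum 0, hence 0. Writing A = B Bᴴ, the
corresponding rows of B vanish. -/
theorem Matrix.PosSemidef.eq_single {A : Matrix X X ℂ} (hA : A.PosSemidef) {x : X}
    (h : A x x = A.trace) : A = Matrix.single x x (A x x) := by
  have hd : ∀ i, i ≠ x → A i i = 0 := by
    have h' : ∑ i ∈ Finset.univ.erase x, A i i = 0 := by
      have := Finset.add_sum_erase Finset.univ (fun i => A i i) (Finset.mem_univ x)
      rw [trace] at h
      simp only [diag_apply] at h
      rw [← h] at this
      exact left_eq_add.mp this.symm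
    rw [Finset.sum_eq_zero_iff_of_nonneg fun i _ => hA.diag_nonneg] at h'
    exact fun i hi => h' i (Finset.mem_erase.mpr ⟨hi, Finset.mem_univ i⟩)
  obtain ⟨B, hB⟩ := hA.exists_eq_mul_conjTranspose
  have hrow : ∀ i, i ≠ x → ∀ k, B i k = 0 := by
    intro i hi k
    have h0 := hd i hi
    rw [hB, mul_apply] at h0
    simp only [conjTranspose_apply, Complex.star_def, Complex.mul_conj] at h0
    norm_cast at h0
    rw [Finset.sum_eq_zero_iff_of_nonneg fun _ _ => Complex.normSq_nonneg _] at h0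
    exact Complex.normSq_eq_zero.mp (h0 k (Finset.mem_univ k))
  ext i j
  rw [single_apply]
  split_ifs with hij
  · rw [← hij.1, ← hij.2]
  · rw [hB, mul_apply]
    refine Finset.sum_eq_zero fun k _ => ?_
    rw [conjTranspose_apply]
    by_cases hi : i = x
    · have hj : j ≠ x := fun hj => hij ⟨hi.symm, hj.symm⟩
      rw [hrow j hj, star_zero, mul_zero]
    · rw [hrow i hi, zero_mul]

end Uniform

/-! ### Perfect decoding bounds the conditional entropy by the mutual information -/

section Decoding

variable {G N X : Type*} [Fintype G] [DecidableEq G] [Fintype N] [DecidableEq N]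
  [Fintype X] [DecidableEq X]

/-- The isometry that adjoins a classical register with value `x`. -/
def tag (G : Type*) [DecidableEq G] {X : Type*} [DecidableEq X] (x : X) : Matrix (G × X) G ℂ :=
  of fun i g => if i = (g, x) then 1 else 0

theorem tag_conjTranspose_mul (x : X) : (tag G x)ᴴ * tag G x = 1 := by
  ext i j
  simp only [tag, mul_apply, conjTranspose_apply, of_apply, apply_ite star, star_one, star_zero,
    one_apply, ite_mul, one_mul, zero_mul, Finset.sum_ite_eq', Finset.mem_univ, if_true,
    Prod.mk.injEq, and_true]

theorem tag_mul_mul_conjTranspose (x : X) (A : Matrix G G ℂ) (i j : G × X) :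
    (tag G x * A * (tag G x)ᴴ) i j = if i.2 = x ∧ j.2 = x then A i.1 j.1 else 0 := by
  obtain ⟨i, y⟩ := i
  obtain ⟨j, z⟩ := j
  by_cases hy : y = x <;> by_cases hz : z = x <;>
    simp [tag, mul_apply, conjTranspose_apply, hy, hz, apply_ite]

theorem tag_kronecker_mul_mul_conjTranspose (x : X) (A : Matrix (G × N) (G × N) ℂ)
    (i j : (G × X) × N) :
    ((tag G x ⊗ₖ (1 : Matrix N N ℂ)) * A * (tag G x ⊗ₖ (1 : Matrix N N ℂ))ᴴ) i j
      = if i.1.2 = x ∧ j.1.2 = x then A (i.1.1, i.2) (j.1.1, j.2) else 0 := by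
  obtain ⟨⟨i, y⟩, m⟩ := i
  obtain ⟨⟨j, z⟩, n⟩ := j
  by_cases hy : y = x <;> by_cases hz : z = x <;>
    simp [tag, mul_apply, conjTranspose_apply, hy, hz, apply_ite, Fintype.sum_prod_type, one_apply]

/-- Moves a classical register from the first to the last position. -/
def registerLast (G N X : Type*) : (G × X) × N ≃ (G × N) × X where
  toFun i := ((i.1.1, i.2), i.1.2)
  invFun i := ((i.1.1, i.2), i.1.2)
  left_inv _ := rfl
  right_inv _ := rfl

variable {R₁ R₂ κ l μ : Type*} [Fintype R₁] [DecidableEq R₁] [Fintype R₂] [DecidableEq R₂]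
  [Fintype κ] [Fintype l] [Fintype μ]

theorem mul_kraus_mul_conjTranspose {a b : Type*} [Fintype a] [Fintype b] (P : Matrix a b ℂ)
    (L : κ → Matrix b R₁ ℂ) (Y : Matrix R₁ R₁ ℂ) :
    P * kraus L Y * Pᴴ = kraus (fun k => P * L k) Y := by
  simp only [kraus, Matrix.mul_sum, Matrix.sum_mul, conjTranspose_mul, Matrix.mul_assoc]

theorem kraus_tagged (L : X → κ → Matrix G R₁ ℂ) (Y : Matrix R₁ R₁ ℂ) :
    kraus (fun k : X × κ => tag G k.1 * L k.1 k.2) Y = blockDiagonal fun x => kraus (L x) Y := by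
  have h : kraus (fun k : X × κ => tag G k.1 * L k.1 k.2) Y
      = ∑ x, tag G x * kraus (L x) Y * (tag G x)ᴴ := by
    simp only [mul_kraus_mul_conjTranspose]
    simp only [kraus, Fintype.sum_prod_type]
  rw [h]
  ext ⟨i, y⟩ ⟨j, z⟩
  simp only [Matrix.sum_apply, tag_mul_mul_conjTranspose, blockDiagonal_apply]
  by_cases hyz : y = z
  · subst hyz; simp
  · rw [if_neg hyz]
    exact Finset.sum_eq_zero fun x _ => if_neg fun hx => hyz (hx.1.trans hx.2.symm)

theorem kraus_krausTensor_tagged (L : X → κ → Matrix G R₁ ℂ) (Γ : l → Matrix N R₂ ℂ)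
    (Y : Matrix (R₁ × R₂) (R₁ × R₂) ℂ) :
    kraus (krausTensor (fun k : X × κ => tag G k.1 * L k.1 k.2) Γ) Y
      = (blockDiagonal fun x => kraus (krausTensor (L x) Γ) Y).submatrix
        (registerLast G N X) (registerLast G N X) := by
  have e : ∀ (x : X) (k : κ) (m : l), (tag G x * L x k) ⊗ₖ Γ m
      = (tag G x ⊗ₖ (1 : Matrix N N ℂ)) * (L x k ⊗ₖ Γ m) := by
    intro x k m
    rw [← mul_kronecker_mul, Matrix.one_mul]
  have h : kraus (krausTensor (fun k : X × κ => tag G k.1 * L k.1 k.2) Γ) Y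
      = ∑ x, (tag G x ⊗ₖ (1 : Matrix N N ℂ)) * kraus (krausTensor (L x) Γ) Y
        * (tag G x ⊗ₖ (1 : Matrix N N ℂ))ᴴ := by
    simp only [mul_kraus_mul_conjTranspose]
    simp only [kraus, krausTensor, Fintype.sum_prod_type, e]
  rw [h]
  ext ⟨⟨i, y⟩, m⟩ ⟨⟨j, z⟩, n⟩
  simp only [Matrix.sum_apply, tag_kronecker_mul_mul_conjTranspose, blockDiagonal_apply,
    submatrix_apply, registerLast, Equiv.coe_fn_mk]
  by_cases hyz : y = z
  · subst hyz; simp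
  · rw [if_neg hyz]
    exact Finset.sum_eq_zero fun x _ => if_neg fun hx => hyz (hx.1.trans hx.2.symm)

theorem blockDiagonal_posSemidef {A : X → Matrix G G ℂ} (hA : ∀ x, (A x).PosSemidef) :
    (blockDiagonal A).PosSemidef := by
  choose B hB using fun x => (hA x).exists_eq_mul_conjTranspose
  have : blockDiagonal A = blockDiagonal B * (blockDiagonal B)ᴴ := by
    rw [blockDiagonal_conjTranspose, ← blockDiagonal_mul]
    exact congrArg _ (funext hB)
  rw [this]
  exact posSemidef_self_mul_conjTranspose _

theorem partialTraceSnd_blockDiagonal (A : X → Matrix G G ℂ) :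
    partialTraceSnd (blockDiagonal A) = ∑ x, A x := by
  ext i j
  simp [partialTraceSnd, blockDiagonal_apply, Matrix.sum_apply]

theorem partialTraceFst_blockDiagonal (A : X → Matrix G G ℂ) :
    partialTraceFst (blockDiagonal A) = diagonal fun x => (A x).trace := by
  ext x y
  by_cases h : x = y
  · subst h; simp [partialTraceFst, blockDiagonal_apply, trace]
  · simp [partialTraceFst, blockDiagonal_apply, h]

theorem kraus_krausTensor_one_blockDiagonal {c : Type*} [Fintype c] [DecidableEq c]
    (D : μ → Matrix c G ℂ) (A : X → Matrix G G ℂ) :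
    kraus (krausTensor D fun _ : Unit => (1 : Matrix X X ℂ)) (blockDiagonal A)
      = blockDiagonal fun x => kraus D (A x) := by
  have e : ∀ k, D k ⊗ₖ (1 : Matrix X X ℂ) = blockDiagonal fun _ => D k := fun k =>
    kronecker_one _
  have hs : ∀ f : μ → X → Matrix c c ℂ,
      ∑ k, blockDiagonal (f k) = blockDiagonal fun x => ∑ k, f k x := by
    intro f
    ext i j
    simp only [Matrix.sum_apply, blockDiagonal_apply]
    split_ifs <;> simp
  simp only [kraus, krausTensor, Fintype.sum_prod_type, Finset.univ_unique, Finset.sum_singleton, e,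
    blockDiagonal_conjTranspose, ← blockDiagonal_mul, hs]

theorem trace_kraus_smul {b d : Type*} [Fintype b] [Fintype d] [DecidableEq d] {K : κ → Matrix b d ℂ}
    {w : ℂ} (hK : ∑ k, (K k)ᴴ * K k = w • 1) (Y : Matrix d d ℂ) :
    (kraus K Y).trace = w * Y.trace := by
  classical
  have := trace_kraus_mul K Y 1
  simpa [krausDual, hK] using this

theorem krausDual_tensor_smul {L : κ → Matrix G R₁ ℂ} {Γ : l → Matrix N R₂ ℂ} {w : ℂ}
    (hL : ∑ k, (L k)ᴴ * L k = w • 1) (hΓ : ∑ k, (Γ k)ᴴ * Γ k = 1) :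
    ∑ k, (krausTensor L Γ k)ᴴ * krausTensor L Γ k = w • 1 := by
  simp only [krausTensor, conjTranspose_kronecker, ← mul_kronecker_mul]
  rw [sum_kronecker_sum (fun k => (L k)ᴴ * L k) (fun k => (Γ k)ᴴ * Γ k), hL, hΓ, smul_kronecker,
    one_kronecker_one]

theorem partialTraceFst_kraus_smul {L : κ → Matrix G R₁ ℂ} {w : ℂ}
    (hL : ∑ k, (L k)ᴴ * L k = w • 1) (Γ : l → Matrix N R₂ ℂ)
    (Y : Matrix (R₁ × R₂) (R₁ × R₂) ℂ) :
    partialTraceFst (kraus (krausTensor L Γ) Y) = w • kraus Γ (partialTraceFst Y) := by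
  refine ext_iff_trace_mul_right.mpr fun Z => ?_
  rw [trace_partialTraceFst_mul, trace_kraus_mul, smul_mul, trace_smul, trace_kraus_mul,
    trace_partialTraceFst_mul, krausDual_krausTensor]
  simp [krausDual, hL, smul_kronecker]

/-- If a uniformly random `x`, encoded on the first side of `ρ`, can be decoded perfectly with the
help of the second side, then the mutual information of `ρ` is at least the conditional entropy of
`x` given the first side. -/
theorem entropy_sub_le_of_decodable [Nonempty X] {L : X → κ → Matrix G R₁ ℂ}
    {Γ : l → Matrix N R₂ ℂ} {Δ : μ → Matrix X (G × N) ℂ} {ρ : Matrix (R₁ × R₂) (R₁ × R₂) ℂ}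
    (hL : ∀ x, ∑ k, (L x k)ᴴ * L x k = (Fintype.card X : ℂ)⁻¹ • 1)
    (hΓ : ∑ k, (Γ k)ᴴ * Γ k = 1) (hΔ : ∑ k, (Δ k)ᴴ * Δ k = 1)
    (hρ : ρ.PosSemidef) (htr : ρ.trace = 1)
    (hdec : ∀ x, kraus Δ (kraus (krausTensor (L x) Γ) ρ) x x = (Fintype.card X : ℂ)⁻¹) :
    spectralEntropy (blockDiagonal fun x => kraus (L x) (partialTraceSnd ρ))
      - spectralEntropy (∑ x, kraus (L x) (partialTraceSnd ρ)) ≤ matrixMutualInfo ρ := by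
  set w := (Fintype.card X : ℂ)⁻¹ with hw
  have hcard : (Fintype.card X : ℂ) ≠ 0 := by simp
  have hsumw : ∑ _x : X, w = 1 := by simp [hw, hcard]
  set ω : X → Matrix (G × N) (G × N) ℂ := fun x => kraus (krausTensor (L x) Γ) ρ with hω
  have hωpos : ∀ x, (ω x).PosSemidef := fun x => kraus_posSemidef _ hρ
  have hωtr : ∀ x, (ω x).trace = w := fun x => by
    rw [hω]
    simp only
    rw [trace_kraus_smul (krausDual_tensor_smul (hL x) hΓ), htr, mul_one]
  have hE : ∑ k : X × κ, (tag G k.1 * L k.1 k.2)ᴴ * (tag G k.1 * L k.1 k.2) = 1 := by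
    have : ∀ k : X × κ, (tag G k.1 * L k.1 k.2)ᴴ * (tag G k.1 * L k.1 k.2)
        = (L k.1 k.2)ᴴ * L k.1 k.2 := fun k => by
      rw [conjTranspose_mul, Matrix.mul_assoc, ← Matrix.mul_assoc (tag G k.1)ᴴ,
        tag_conjTranspose_mul, Matrix.one_mul]
    simp only [this, Fintype.sum_prod_type, hL]
    rw [← Finset.sum_smul, hsumw, one_smul]
  -- Preparing a random x on the first side and keeping it as a register is a local channel: S(GX) +
  -- S(N) - S(GNX) ≤ I(ρ).
  have h1 := matrixMutualInfo_krausTensor_le hE hΓ hρ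
  rw [matrixMutualInfo, partialTraceSnd_kraus _ hΓ, partialTraceFst_kraus hE, kraus_tagged,
    kraus_krausTensor_tagged, spectralEntropy_submatrix_equiv] at h1
  have hid : ∑ _k : Unit, (1 : Matrix X X ℂ)ᴴ * (1 : Matrix X X ℂ) = 1 := by simp
  -- Decoding GN gives a perfect copy of x, so log |X| ≤ I(GN:X), which amounts to S(GNX) ≤ S(GN).
  have h2 := matrixMutualInfo_krausTensor_le hΔ hid (blockDiagonal_posSemidef hωpos)
  have hdecω : ∀ x, kraus Δ (ω x) = Matrix.single x x w := fun x => by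
    have := (kraus_posSemidef Δ (hωpos x)).eq_single (x := x)
      (by rw [trace_kraus hΔ, hωtr]; exact hdec x)
    rwa [show kraus Δ (ω x) x x = w from hdec x] at this
  have hsmul : (diagonal fun _ : X => w) = w • 1 := by rw [smul_one_eq_diagonal]
  rw [kraus_krausTensor_one_blockDiagonal] at h2
  simp only [hdecω] at h2
  rw [matrixMutualInfo_correlated, matrixMutualInfo, partialTraceSnd_blockDiagonal,
    partialTraceFst_blockDiagonal] at h2
  simp only [hωtr] at h2
  rw [hsmul, hw, spectralEntropy_smul_one] at h2
  have hpos : (∑ x, ω x).PosSemidef := posSemidef_sum _ fun x _ => hωpos x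
  -- Subadditivity S(GN) ≤ S(G) + S(N) closes the chain to S(GX) - S(G) ≤ I(ρ).
  have h3 := matrixMutualInfo_nonneg hpos (by rw [trace_sum]; simp only [hωtr]; exact hsumw)
  have e1 : partialTraceSnd (∑ x, ω x) = ∑ x, kraus (L x) (partialTraceSnd ρ) := by
    rw [← Finset.sum_congr rfl fun x _ => partialTraceSnd_kraus (L x) hΓ ρ]
    ext i j
    simp only [partialTraceSnd, of_apply, Matrix.sum_apply]
    rw [Finset.sum_comm]
  have e2 : partialTraceFst (∑ x, ω x) = kraus Γ (partialTraceFst ρ) := by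
    have : ∑ x, partialTraceFst (ω x) = kraus Γ (partialTraceFst ρ) := by
      simp only [hω, partialTraceFst_kraus_smul (hL _) Γ]
      rw [← Finset.sum_smul, hsumw, one_smul]
    rw [← this]
    ext i j
    simp only [partialTraceFst, of_apply, Matrix.sum_apply]
    rw [Finset.sum_comm]
  rw [matrixMutualInfo, e1, e2] at h3
  linarith

end Decoding

/-! ### Entropic uncertainty relation with quantum memory -/

section Uncertainty

variable {X κ G₁ G₂ : Type*} [Fintype X] [DecidableEq X] [Fintype κ] [DecidableEq κ]
  [Fintype G₁] [DecidableEq G₁] [Fintype G₂] [DecidableEq G₂]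

/-- The reduced matrix on the first output system of the vector `t`. -/
def reducedFst (t : κ → G₁ → G₂ → ℂ) : Matrix G₁ G₁ ℂ :=
  of fun i j => ∑ k, ∑ g, t k i g * star (t k j g)

/-- The reduced matrix on the second output system of the vector `t`. -/
def reducedSnd (t : κ → G₁ → G₂ → ℂ) : Matrix G₂ G₂ ℂ :=
  of fun i j => ∑ k, ∑ g, t k g i * star (t k g j)

/-- The measurement of the reference system in the basis given by `u`, keeping the second output
system. -/
def measureRef (u : X → X → ℂ) (k : X × κ) : Matrix (G₂ × X) ((G₂ × κ) × X) ℂ :=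
  of fun i j => if i.2 = k.1 then if j.1.2 = k.2 then if i.1 = j.1.1 then u k.1 j.2 else 0 else 0 else 0

theorem measureRef_complete {u : X → X → ℂ}
    (hu : ∀ x y, ∑ z, star (u z x) * u z y = if x = y then 1 else 0) :
    ∑ k : X × κ, (measureRef (G₂ := G₂) u k)ᴴ * measureRef (G₂ := G₂) u k = 1 := by
  ext ⟨⟨g, k⟩, x⟩ ⟨⟨g', k'⟩, y⟩
  rw [Matrix.sum_apply, Fintype.sum_prod_type]
  simp only [measureRef, mul_apply, conjTranspose_apply, of_apply, Fintype.sum_prod_type,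
    apply_ite star, star_zero, mul_ite, ite_mul, mul_zero, zero_mul,
    Finset.sum_ite_eq', Finset.mem_univ, if_true, one_apply, Prod.mk.injEq]
  by_cases hg : g = g' <;> by_cases hk : k = k' <;> simp [hg, hk]
  · simpa using hu x y
  · exact fun h => absurd h.symm hg

theorem sum_mul_sum_mul_star (c : X → ℂ) (f f' : X → G₁ → ℂ) :
    ∑ x, ∑ y, c x * (∑ g, f x g * star (f' y g)) * star (c y)
      = ∑ g, (∑ x, c x * f x g) * star (∑ y, c y * f' y g) := by
  simp only [star_sum, star_mul', Finset.sum_mul_sum]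
  simp only [Finset.mul_sum, Finset.sum_mul]
  rw [Finset.sum_comm (s := Finset.univ (α := G₁))]
  refine Finset.sum_congr rfl fun x _ => ?_
  rw [Finset.sum_comm]
  refine Finset.sum_congr rfl fun g _ => Finset.sum_congr rfl fun y _ => ?_
  ring

theorem sum_mul_star_eq_of_unitary {u : X → X → ℂ}
    (hu : ∀ x y, ∑ z, star (u z x) * u z y = if x = y then 1 else 0) (f f' : X → ℂ) :
    ∑ z, (∑ x, u z x * f x) * star (∑ y, u z y * f' y) = ∑ x, f x * star (f' x) := by
  have h : ∀ z, (∑ x, u z x * f x) * star (∑ y, u z y * f' y)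
      = ∑ x, ∑ y, f x * star (f' y) * (star (u z y) * u z x) := by
    intro z
    simp only [star_sum, star_mul', Finset.sum_mul_sum]
    exact Finset.sum_congr rfl fun x _ => Finset.sum_congr rfl fun y _ => by ring
  simp only [h]
  rw [Finset.sum_comm]
  refine Finset.sum_congr rfl fun x _ => ?_
  rw [Finset.sum_comm]
  simp only [← Finset.mul_sum, hu, mul_ite, mul_one, mul_zero, Finset.sum_ite_eq',
    Finset.mem_univ, if_true]

theorem measureRef_mul_apply {m : Type*} (u : X → X → ℂ) (x : X) (k : κ)
    (Y : Matrix ((G₂ × κ) × X) m ℂ) (i : G₂ × X) (j : m) :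
    (measureRef (G₂ := G₂) u (x, k) * Y) i j
      = if i.2 = x then ∑ y, u x y * Y ((i.1, k), y) j else 0 := by
  simp only [measureRef, mul_apply, of_apply, Fintype.sum_prod_type, ite_mul, zero_mul,
    Finset.sum_ite_irrel, Finset.sum_const_zero, Finset.sum_ite_eq, Finset.sum_ite_eq',
    Finset.mem_univ, if_true]

theorem mul_measureRef_conjTranspose_apply {m : Type*} (u : X → X → ℂ) (x : X) (k : κ)
    (Y : Matrix m ((G₂ × κ) × X) ℂ) (i : m) (j : G₂ × X) :
    (Y * (measureRef (G₂ := G₂) u (x, k))ᴴ) i j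
      = if j.2 = x then ∑ y, Y i ((j.1, k), y) * star (u x y) else 0 := by
  simp only [measureRef, mul_apply, of_apply, Fintype.sum_prod_type, mul_ite, mul_zero,
    conjTranspose_apply, apply_ite star, star_zero,
    Finset.sum_ite_irrel, Finset.sum_const_zero, Finset.sum_ite_eq, Finset.sum_ite_eq',
    Finset.mem_univ, if_true]

theorem kraus_measureRef_apply (u : X → X → ℂ) (Y : Matrix ((G₂ × κ) × X) ((G₂ × κ) × X) ℂ)
    (i j : G₂ × X) :
    kraus (measureRef u) Y i j = if i.2 = j.2 then
      ∑ k, ∑ x, ∑ y, u i.2 x * Y ((i.1, k), x) ((j.1, k), y) * star (u i.2 y) else 0 := by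
  obtain ⟨g, z⟩ := i
  obtain ⟨g', z'⟩ := j
  rw [kraus, Matrix.sum_apply, Fintype.sum_prod_type]
  have e : ∀ x k, (measureRef (G₂ := G₂) u (x, k) * Y * (measureRef (G₂ := G₂) u (x, k))ᴴ) (g, z) (g', z')
      = if z = x then if z' = x then
        ∑ a, ∑ b, u x a * Y ((g, k), a) ((g', k), b) * star (u x b) else 0 else 0 := by
    intro x k
    rw [mul_measureRef_conjTranspose_apply]
    simp only [measureRef_mul_apply]
    split_ifs
    · simp only [Finset.sum_mul]
      rw [Finset.sum_comm]
    · simp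
    · rfl
    · rfl
  simp only [e, Finset.sum_ite_irrel, Finset.sum_const_zero, Finset.sum_ite_eq, Finset.mem_univ,
    if_true, eq_comm]

/-- The entropic uncertainty relation with quantum memory for two mutually unbiased bases. -/
theorem log_card_le_entropy_add_entropy [Nonempty X] (t t' : X → κ → G₁ → G₂ → ℂ) (u : X → X → ℂ)
    (hu : ∀ x y, ∑ z, star (u z x) * u z y = if x = y then 1 else 0)
    (hub : ∀ z x, u z x * star (u z x) = (Fintype.card X : ℂ)⁻¹)
    (ht' : ∀ z k i j, t' z k i j = ∑ x, u z x * t x k i j)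
    (htr : ∀ z, (reducedSnd (t' z)).trace = (Fintype.card X : ℂ)⁻¹) :
    Real.log (Fintype.card X) ≤
      (spectralEntropy (blockDiagonal fun x => reducedFst (t x))
        - spectralEntropy (∑ x, reducedFst (t x)))
      + (spectralEntropy (blockDiagonal fun z => reducedSnd (t' z))
        - spectralEntropy (∑ z, reducedSnd (t' z))) := by
  -- The family t is read as a pure vector on X, κ, G₁, G₂. As a matrix from G₁ to the rest it is F,
  -- so F Fᴴ is the state complementary to G₁; N x is its block at x.
  set N : X → Matrix (G₂ × κ) G₁ ℂ := fun x => of fun c g => t x c.2 g c.1 with hN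
  set F : Matrix ((G₂ × κ) × X) G₁ ℂ := of fun c g => t c.2 c.1.2 g c.1.1 with hF
  have hNN : ∀ x, (N x)ᴴ * N x = (reducedFst (t x))ᵀ := by
    intro x
    ext i j
    simp only [hN, mul_apply, conjTranspose_apply, of_apply, transpose_apply, reducedFst,
      Fintype.sum_prod_type_right, mul_comm]
  have hFF : Fᴴ * F = (∑ x, reducedFst (t x))ᵀ := by
    ext i j
    simp only [hF, mul_apply, conjTranspose_apply, of_apply, transpose_apply, reducedFst,
      Fintype.sum_prod_type_right, mul_comm, Matrix.sum_apply]
  -- The relative entropy to the pinching in the X basis equals H(X|G₁), after passing to the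
  -- complementary system G₁.
  have hrel : IsRelEnt (F * Fᴴ) (blockDiagonal fun x => N x * (N x)ᴴ) _ :=
    isRelEnt_blockDiagonal (fun x => posSemidef_self_mul_conjTranspose _) fun x i j => by
      simp [hN, hF, mul_apply]
  have hS1 : spectralEntropy (blockDiagonal fun x => N x * (N x)ᴴ)
      = spectralEntropy (blockDiagonal fun x => reducedFst (t x)) := by
    rw [blockDiagonal_mul, spectralEntropy_mul_comm, ← blockDiagonal_mul]
    simp only [hNN]
    rw [← blockDiagonal_transpose, spectralEntropy_transpose]
  rw [spectralEntropy_mul_comm F, hFF, spectralEntropy_transpose, hS1] at hrel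
  have hout : kraus (measureRef u) (F * Fᴴ) = blockDiagonal fun z => reducedSnd (t' z) := by
    ext ⟨g, z⟩ ⟨g', z'⟩
    rw [kraus_measureRef_apply, blockDiagonal_apply]
    refine if_congr Iff.rfl ?_ rfl
    simp only [reducedSnd, of_apply, ht', hF, mul_apply, conjTranspose_apply]
    exact Finset.sum_congr rfl fun k _ =>
      sum_mul_sum_mul_star (u z) (fun x i => t x k i g) fun x i => t x k i g'
  have hparseval : ∑ z, reducedSnd (t' z) = ∑ x, reducedSnd (t x) := by
    ext g g'
    simp only [Matrix.sum_apply, reducedSnd, of_apply, ht']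
    rw [Finset.sum_comm, Finset.sum_comm (s := Finset.univ (α := X))]
    refine Finset.sum_congr rfl fun k _ => ?_
    rw [Finset.sum_comm, Finset.sum_comm (s := Finset.univ (α := X))]
    exact Finset.sum_congr rfl fun i _ => sum_mul_star_eq_of_unitary hu _ _
  -- Measuring the pinched state in an unbiased basis leaves a uniform outcome uncorrelated with G₂.
  have hout' : kraus (measureRef u) (blockDiagonal fun x => N x * (N x)ᴴ)
      = (∑ z, reducedSnd (t' z)) ⊗ₖ ((Fintype.card X : ℂ)⁻¹ • (1 : Matrix X X ℂ)) := by
    rw [hparseval]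
    ext ⟨g, z⟩ ⟨g', z'⟩
    rw [kraus_measureRef_apply, kroneckerMap_apply, Matrix.smul_apply, one_apply]
    split_ifs with h
    · simp only [blockDiagonal_apply, mul_ite, ite_mul, mul_zero, zero_mul, Finset.sum_ite_eq,
        Finset.mem_univ, if_true, mul_right_comm _ _ (star _), hub, hN, mul_apply, reducedSnd,
        conjTranspose_apply, of_apply, Matrix.sum_apply, smul_eq_mul, mul_one]
      rw [Finset.sum_comm, Finset.sum_mul]
      simp only [Finset.sum_mul, mul_comm (Fintype.card X : ℂ)⁻¹]
    · simp
  have hFpos : (F * Fᴴ).PosSemidef := posSemidef_self_mul_conjTranspose _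
  -- The measured pair is a state and the product of its marginals, with relative entropy log |X| -
  -- H(Z|G₂); monotonicity bounds it by H(X|G₁).
  have hmarg := isRelEnt_marginals (kraus_posSemidef (measureRef (G₂ := G₂) u) hFpos)
  have e1 : partialTraceSnd (kraus (measureRef u) (F * Fᴴ)) = ∑ z, reducedSnd (t' z) := by
    rw [hout, partialTraceSnd_blockDiagonal]
  have e2 : partialTraceFst (kraus (measureRef (G₂ := G₂) u) (F * Fᴴ))
      = (Fintype.card X : ℂ)⁻¹ • (1 : Matrix X X ℂ) := by
    rw [hout, partialTraceFst_blockDiagonal]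
    simp only [htr]
    rw [smul_one_eq_diagonal]
  rw [matrixMutualInfo, e1, e2, ← hout'] at hmarg
  have := hrel.kraus_le (measureRef_complete hu) hFpos hmarg
  rw [hout, spectralEntropy_smul_one] at this
  linarith

end Uncertainty

/-! ### Channels with a fixed input vector and one output discarded -/

section Slices

variable {A R G ι M κ : Type*} [Fintype A] [DecidableEq A] [Fintype R] [DecidableEq R]
  [Fintype G] [Fintype ι] [Fintype M] [Fintype κ]

/-- The operator `|r⟩ ↦ |v⟩|r⟩`. -/
def embed (R : Type*) [DecidableEq R] {A : Type*} (v : A → ℂ) : Matrix (A × R) R ℂ :=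
  of fun i r => if i.2 = r then v i.1 else 0

theorem embed_conjTranspose_mul (v : A → ℂ) :
    (embed R v)ᴴ * embed R v = (∑ a, star (v a) * v a) • 1 := by
  ext i j
  simp only [embed, mul_apply, conjTranspose_apply, of_apply, Fintype.sum_prod_type,
    apply_ite star, star_zero, ite_mul, mul_ite, zero_mul, mul_zero, Finset.sum_ite_eq,
    Finset.mem_univ, if_true, Matrix.smul_apply, one_apply, smul_eq_mul,
    mul_one, Finset.sum_ite_irrel, Finset.sum_const_zero, eq_comm]

/-- The Kraus family that inserts the vector `v`, applies `K` and traces out the system `ι`, where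
the output is split by `e`. -/
def slice (e : G × ι ≃ M) (K : κ → Matrix M (A × R) ℂ) (v : A → ℂ) (k : κ × ι) : Matrix G R ℂ :=
  (K k.1 * embed R v).submatrix (fun g => e (g, k.2)) id

theorem slice_complete (e : G × ι ≃ M) {K : κ → Matrix M (A × R) ℂ}
    (hK : ∑ k, (K k)ᴴ * K k = 1) (v : A → ℂ) :
    ∑ k, (slice e K v k)ᴴ * slice e K v k = (∑ a, star (v a) * v a) • 1 := by
  have h : ∀ B : Matrix M R ℂ, ∑ m, (B.submatrix (fun g => e (g, m)) id)ᴴ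
      * B.submatrix (fun g => e (g, m)) id = Bᴴ * B := by
    intro B
    ext i j
    simp only [Matrix.sum_apply, mul_apply, conjTranspose_apply, submatrix_apply, id]
    rw [← Equiv.sum_comp e, Fintype.sum_prod_type_right]
  simp only [slice, Fintype.sum_prod_type, h, conjTranspose_mul]
  have h2 : ∀ k, (embed R v)ᴴ * (K k)ᴴ * (K k * embed R v)
      = (embed R v)ᴴ * ((K k)ᴴ * K k) * embed R v := fun k => by simp only [Matrix.mul_assoc]
  simp only [h2]
  rw [← Matrix.sum_mul, ← Matrix.mul_sum, hK, Matrix.mul_one, embed_conjTranspose_mul]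

theorem slice_smul (e : G × ι ≃ M) (K : κ → Matrix M (A × R) ℂ) (c : ℂ) (v : A → ℂ) (k : κ × ι) :
    slice e K (c • v) k = c • slice e K v k := by
  have : embed R (c • v) = c • embed R v := by
    ext i j
    simp [embed]
  rw [slice, this, Matrix.mul_smul]
  rfl

/-- Discarding the messages for the other output point keeps the product form of the two local
operations, as `entropy_sub_le_of_decodable` requires. -/
theorem sum_submatrix_kraus {A' R' N ι' M' κ' : Type*} [Fintype A'] [DecidableEq A'] [Fintype R']
    [DecidableEq R'] [Fintype N] [Fintype ι'] [Fintype M'] [Fintype κ'] (e : G × ι ≃ M)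
    (e' : N × ι' ≃ M') (K : κ → Matrix M (A × R) ℂ) (K' : κ' → Matrix M' (A' × R') ℂ)
    (v : A → ℂ) (v' : A' → ℂ) (Y : Matrix (R × R') (R × R') ℂ) :
    ∑ m, ∑ m', (kraus (krausTensor K K')
        ((embed R v ⊗ₖ embed R' v') * Y * (embed R v ⊗ₖ embed R' v')ᴴ)).submatrix
          (fun i : G × N => (e (i.1, m), e' (i.2, m'))) (fun i : G × N => (e (i.1, m), e' (i.2, m')))
      = kraus (krausTensor (slice e K v) (slice e' K' v')) Y := by
  have h1 : kraus (krausTensor K K')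
        ((embed R v ⊗ₖ embed R' v') * Y * (embed R v ⊗ₖ embed R' v')ᴴ)
      = ∑ k, ∑ k', ((K k * embed R v) ⊗ₖ (K' k' * embed R' v')) * Y
        * ((K k * embed R v) ⊗ₖ (K' k' * embed R' v'))ᴴ := by
    simp only [kraus, krausTensor, Fintype.sum_prod_type, mul_kronecker_mul, conjTranspose_mul,
      Matrix.mul_assoc]
  have h2 : ∀ (k : κ) (k' : κ') (m : ι) (m' : ι'),
      (((K k * embed R v) ⊗ₖ (K' k' * embed R' v')) * Y
        * ((K k * embed R v) ⊗ₖ (K' k' * embed R' v'))ᴴ).submatrix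
          (fun i : G × N => (e (i.1, m), e' (i.2, m'))) (fun i : G × N => (e (i.1, m), e' (i.2, m')))
      = (slice e K v (k, m) ⊗ₖ slice e' K' v' (k', m')) * Y
        * (slice e K v (k, m) ⊗ₖ slice e' K' v' (k', m'))ᴴ := by
    intro k k' m m'
    rfl
  rw [h1]
  simp only [kraus, krausTensor, Fintype.sum_prod_type, ← h2]
  ext i j
  simp only [Matrix.sum_apply, submatrix_apply]
  exact (Finset.sum_congr rfl fun m _ => Finset.sum_comm).trans (Finset.sum_comm.trans
    (Finset.sum_congr rfl fun k _ => Finset.sum_congr rfl fun m _ => Finset.sum_comm))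

theorem kraus_krausTensor_smul {a b c d l : Type*} [Fintype a] [Fintype b] [Fintype l]
    (L : κ → Matrix c a ℂ) (Γ : l → Matrix d b ℂ) (z : ℂ) (Y : Matrix (a × b) (a × b) ℂ) :
    kraus (krausTensor (fun k => z • L k) Γ) Y = (z * star z) • kraus (krausTensor L Γ) Y := by
  simp only [kraus, krausTensor, smul_kronecker, conjTranspose_smul, Matrix.smul_mul,
    Matrix.mul_smul, smul_smul, Finset.smul_sum, mul_comm]

/-- B purifies the resource marginal B Bᴴ. The environment index pairs the Kraus label of the
channel with the purifying system, so both outputs are reductions of one pure vector. -/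
theorem reducedFst_eq_kraus_slice {G₁ G₂ : Type*} [Fintype G₁] [Fintype G₂]
    (K : κ → Matrix (G₁ × G₂) (A × R) ℂ) (v : A → ℂ) (B : Matrix R R ℂ) :
    reducedFst (fun (k : κ × R) i j => (K k.1 * embed R v * B) (i, j) k.2)
      = kraus (slice (Equiv.refl _) K v) (B * Bᴴ) := by
  have h : ∀ k, slice (Equiv.refl _) K v k * (B * Bᴴ) * (slice (Equiv.refl _) K v k)ᴴ
      = ((K k.1 * embed R v * B).submatrix (fun g => (g, k.2)) id)
        * ((K k.1 * embed R v * B).submatrix (fun g => (g, k.2)) id)ᴴ := by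
    intro k
    have : ((K k.1 * embed R v * B).submatrix (fun g => (g, k.2)) id)
        = slice (Equiv.refl _) K v k * B := rfl
    rw [this, conjTranspose_mul]
    simp only [Matrix.mul_assoc]
  simp only [kraus, h]
  ext i j
  simp only [reducedFst, of_apply, Matrix.sum_apply, Fintype.sum_prod_type,
    mul_apply (M := submatrix _ _ _), conjTranspose_apply, submatrix_apply, id]
  exact Finset.sum_congr rfl fun k _ => Finset.sum_comm

theorem reducedSnd_eq_kraus_slice {G₁ G₂ : Type*} [Fintype G₁] [Fintype G₂]
    (K : κ → Matrix (G₁ × G₂) (A × R) ℂ) (v : A → ℂ) (B : Matrix R R ℂ) :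
    reducedSnd (fun (k : κ × R) i j => (K k.1 * embed R v * B) (i, j) k.2)
      = kraus (slice (Equiv.prodComm _ _) K v) (B * Bᴴ) := by
  have h : ∀ k, slice (Equiv.prodComm _ _) K v k * (B * Bᴴ) * (slice (Equiv.prodComm _ _) K v k)ᴴ
      = ((K k.1 * embed R v * B).submatrix (fun g => (k.2, g)) id)
        * ((K k.1 * embed R v * B).submatrix (fun g => (k.2, g)) id)ᴴ := by
    intro k
    have : ((K k.1 * embed R v * B).submatrix (fun g => (k.2, g)) id)
        = slice (Equiv.prodComm _ _) K v k * B := rfl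
    rw [this, conjTranspose_mul]
    simp only [Matrix.mul_assoc]
  simp only [kraus, h]
  ext i j
  simp only [reducedSnd, of_apply, Matrix.sum_apply, Fintype.sum_prod_type,
    mul_apply (M := submatrix _ _ _), conjTranspose_apply, submatrix_apply, id]
  exact Finset.sum_congr rfl fun k _ => Finset.sum_comm

end Slices

/-! ### BB84 states: orthonormality and unbiasedness -/

section BB84

theorem hadamard_conjTranspose : hadamardᴴ = hadamard := by
  ext i j
  fin_cases i <;> fin_cases j <;> simp [hadamard]

theorem hadamard_mul_self : hadamard * hadamard = 1 := by
  have h : ((1 / Real.sqrt 2 : ℝ) : ℂ) * ((1 / Real.sqrt 2 : ℝ) : ℂ) = 1 / 2 := by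
    rw [← Complex.ofReal_mul, div_mul_div_comm, Real.mul_self_sqrt (by norm_num)]
    norm_num
  rw [hadamard, Matrix.smul_mul, Matrix.mul_smul, smul_smul, h]
  ext i j
  fin_cases i <;> fin_cases j <;> norm_num [mul_apply, Fin.sum_univ_two]

theorem hadamard_mul_star (x y : Fin 2) : hadamard x y * star (hadamard x y) = 2⁻¹ := by
  have h : ((1 / Real.sqrt 2 : ℝ) : ℂ) * ((1 / Real.sqrt 2 : ℝ) : ℂ) = 2⁻¹ := by
    rw [← Complex.ofReal_mul, div_mul_div_comm, Real.mul_self_sqrt (by norm_num)]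
    norm_num
  fin_cases x <;> fin_cases y <;> simpa [hadamard, mul_comm] using h

theorem hadamard_pow_unitary (q : Fin 2) :
    (hadamard ^ (q : ℕ))ᴴ * hadamard ^ (q : ℕ) = 1 := by
  fin_cases q
  · simp
  · simp [hadamard_conjTranspose, hadamard_mul_self]

variable {n : ℕ}

theorem sum_star_bb84Vec_mul (q b b' : Bits n) :
    ∑ x, star (bb84Vec q b x) * bb84Vec q b' x = if b = b' then 1 else 0 := by
  have h : ∀ i, ∑ y : Fin 2, star ((hadamard ^ (q i : ℕ)) y (b i)) * (hadamard ^ (q i : ℕ)) y (b' i)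
      = if b i = b' i then 1 else 0 := fun i => by
    have := congrFun (congrFun (hadamard_pow_unitary (q i)) (b i)) (b' i)
    simpa only [mul_apply, conjTranspose_apply, one_apply] using this
  simp only [bb84Vec, star_prod, ← Finset.prod_mul_distrib]
  rw [← Fintype.prod_sum fun i y =>
    star ((hadamard ^ (q i : ℕ)) y (b i)) * (hadamard ^ (q i : ℕ)) y (b' i)]
  simp only [h]
  by_cases hb : b = b'
  · simp [hb]
  · rw [if_neg hb]
    obtain ⟨i, hi⟩ := Function.ne_iff.mp hb
    exact Finset.prod_eq_zero (Finset.mem_univ i) (if_neg hi)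

theorem bb84Vec_zero (b : Bits n) : bb84Vec (fun _ => 0) b = ket b := by
  ext x
  simp only [bb84Vec, Fin.val_zero, pow_zero, ket, Pi.single_apply, one_apply]
  by_cases hb : x = b
  · simp [hb]
  · rw [if_neg hb]
    obtain ⟨i, hi⟩ := Function.ne_iff.mp hb
    exact Finset.prod_eq_zero (Finset.mem_univ i) (if_neg hi)

theorem bb84Vec_one_symm (b x : Bits n) : bb84Vec (fun _ => 1) b x = bb84Vec (fun _ => 1) x b := by
  have h : ∀ i j, hadamard i j = hadamard j i := fun i j => by
    fin_cases i <;> fin_cases j <;> rfl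
  simp only [bb84Vec, Fin.val_one, pow_one]
  exact Finset.prod_congr rfl fun i _ => h _ _

theorem bb84Vec_one_mul_star (b x : Bits n) :
    bb84Vec (fun _ => 1) b x * star (bb84Vec (fun _ => 1) b x) = (Fintype.card (Bits n) : ℂ)⁻¹ := by
  simp only [bb84Vec, Fin.val_one, pow_one, star_prod, ← Finset.prod_mul_distrib,
    hadamard_mul_star]
  simp

end BB84

/-! ### Protocols that succeed with certainty -/

section Protocol

theorem DensityMatrix.entropy_eq {d : Type*} [Fintype d] [DecidableEq d] (ρ : DensityMatrix d) :
    ρ.entropy = spectralEntropy ρ.mat / Real.log 2 := by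
  rw [DensityMatrix.entropy, spectralEntropy,
    ρ.posSemidef.isHermitian.roots_charpoly_eq_eigenvalues, Multiset.map_map]
  change _ = (∑ i, Real.negMulLog (RCLike.ofReal (ρ.posSemidef.isHermitian.eigenvalues i) : ℂ).re)
    / Real.log 2
  rw [Finset.sum_div, ← Finset.sum_neg_distrib]
  refine Finset.sum_congr rfl fun i _ => ?_
  simp only [Complex.coe_algebraMap, Complex.ofReal_re, Real.negMulLog, Real.logb]
  ring

variable {R₁ R₂ : Type*} [Fintype R₁] [DecidableEq R₁] [Fintype R₂] [DecidableEq R₂]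

theorem DensityMatrix.mutualInformation_eq (ρ : DensityMatrix (R₁ × R₂)) :
    ρ.mutualInformation = matrixMutualInfo ρ.mat / Real.log 2 := by
  rw [DensityMatrix.mutualInformation, DensityMatrix.entropy_eq, DensityMatrix.entropy_eq,
    DensityMatrix.entropy_eq, matrixMutualInfo]
  simp only [DensityMatrix.marginalFst, DensityMatrix.marginalSnd]
  ring

variable {n : ℕ}

theorem B84Protocol.inputState_eq (ρ : DensityMatrix (R₁ × R₂)) (q b : Bits n) :
    B84Protocol.inputState ρ q b
      = (embed R₁ (bb84Vec q b) ⊗ₖ embed R₂ (ket q)) * ρ.mat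
        * (embed R₁ (bb84Vec q b) ⊗ₖ embed R₂ (ket q))ᴴ := by
  ext ⟨⟨a, r⟩, ⟨a', r'⟩⟩ ⟨⟨b, s⟩, ⟨b', s'⟩⟩
  have e : ∀ (v v' : Bits n → ℂ) (a a' : Bits n) (r : R₁) (r' : R₂) (i : R₁ × R₂),
      (embed R₁ v ⊗ₖ embed R₂ v') ((a, r), (a', r')) i = if (r, r') = i then v a * v' a' else 0 := by
    intro v v' a a' r r' i
    obtain ⟨i, i'⟩ := i
    simp only [embed, kroneckerMap_apply, of_apply, Prod.mk.injEq, ite_and, mul_ite, ite_mul,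
      zero_mul, mul_zero]
    split_ifs <;> rfl
  simp only [mul_apply, conjTranspose_apply, e, ite_mul, zero_mul, apply_ite star, star_zero,
    mul_ite, mul_zero, Finset.sum_ite_eq, Finset.mem_univ, if_true]
  simp [B84Protocol.inputState, ketbra, vecMulVec_apply]
  ring

theorem B84Protocol.trace_inputState (ρ : DensityMatrix (R₁ × R₂)) (q b : Bits n) :
    (B84Protocol.inputState ρ q b).trace = 1 := by
  have h1 : ∑ x, star (ket q x) * ket q x = (1 : ℂ) := by
    have := sum_star_bb84Vec_mul (fun _ => 0) q q
    simpa only [bb84Vec_zero, if_true] using this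
  rw [B84Protocol.inputState_eq, trace_mul_comm, ← Matrix.mul_assoc, conjTranspose_kronecker,
    ← mul_kronecker_mul, embed_conjTranspose_mul, embed_conjTranspose_mul, h1,
    sum_star_bb84Vec_mul, if_pos rfl, one_smul, one_smul, one_kronecker_one, Matrix.one_mul,
    ρ.trace_eq_one]

theorem B84Protocol.inputState_posSemidef (ρ : DensityMatrix (R₁ × R₂)) (q b : Bits n) :
    (B84Protocol.inputState ρ q b).PosSemidef := by
  rw [B84Protocol.inputState_eq]
  exact ρ.posSemidef.mul_mul_conjTranspose_same _

variable (P : B84Protocol n R₁ R₂)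

/-- The state of the messages, grouped by their destination. -/
def B84Protocol.messageState (ρ : DensityMatrix (R₁ × R₂)) (q b : Bits n) :
    Matrix ((Fin P.m₁₁ × Fin P.m₂₁) × (Fin P.m₁₂ × Fin P.m₂₂))
      ((Fin P.m₁₁ × Fin P.m₂₁) × (Fin P.m₁₂ × Fin P.m₂₂)) ℂ :=
  Matrix.reindex (Equiv.prodProdProdComm _ _ _ _) (Equiv.prodProdProdComm _ _ _ _)
    (kraus (krausTensor P.atC₁.K P.atC₂.K) (B84Protocol.inputState ρ q b))

theorem B84Protocol.outputState_eq (ρ : DensityMatrix (R₁ × R₂)) (q b : Bits n) :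
    P.outputState ρ q b = kraus (krausTensor P.atR₁.K P.atR₂.K) (P.messageState ρ q b) := rfl

theorem B84Protocol.outputState_posSemidef (ρ : DensityMatrix (R₁ × R₂)) (q b : Bits n) :
    (P.outputState ρ q b).PosSemidef :=
  kraus_posSemidef _ ((kraus_posSemidef (krausTensor P.atC₁.K P.atC₂.K)
    (B84Protocol.inputState_posSemidef ρ q b)).submatrix _)

theorem B84Protocol.trace_outputState (ρ : DensityMatrix (R₁ × R₂)) (q b : Bits n) :
    (P.outputState ρ q b).trace = 1 := by
  rw [B84Protocol.outputState_eq, trace_kraus (sum_krausTensor P.atR₁.complete P.atR₂.complete),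
    B84Protocol.messageState]
  have h : ∀ {a b : Type} [Fintype a] [Fintype b] (e : a ≃ b) (Y : Matrix a a ℂ),
      (Matrix.reindex e e Y).trace = Y.trace := by
    intro a b _ _ e Y
    simp only [trace, diag_apply, reindex_apply, submatrix_apply]
    exact Equiv.sum_comp e.symm fun i => Y i i
  rw [h, trace_kraus (sum_krausTensor P.atC₁.complete P.atC₂.complete),
    B84Protocol.trace_inputState]

theorem partialTraceSnd_messageState (ρ : DensityMatrix (R₁ × R₂)) (q b : Bits n) :
    partialTraceSnd (P.messageState ρ q b)
      = kraus (krausTensor (slice (Equiv.refl _) P.atC₁.K (bb84Vec q b))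
          (slice (Equiv.refl _) P.atC₂.K (ket q))) ρ.mat := by
  rw [← sum_submatrix_kraus, B84Protocol.messageState, B84Protocol.inputState_eq]
  ext i j
  simp only [partialTraceSnd, of_apply, Matrix.sum_apply, Fintype.sum_prod_type]
  rfl

theorem partialTraceFst_messageState (ρ : DensityMatrix (R₁ × R₂)) (q b : Bits n) :
    partialTraceFst (P.messageState ρ q b)
      = kraus (krausTensor (slice (Equiv.prodComm _ _) P.atC₁.K (bb84Vec q b))
          (slice (Equiv.prodComm _ _) P.atC₂.K (ket q))) ρ.mat := by
  rw [← sum_submatrix_kraus, B84Protocol.messageState, B84Protocol.inputState_eq]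
  ext i j
  simp only [partialTraceFst, of_apply, Matrix.sum_apply, Fintype.sum_prod_type]
  rfl

theorem Matrix.PosSemidef.diag_re_le_trace {d : Type*} [Fintype d] {A : Matrix d d ℂ}
    (hA : A.PosSemidef) (i : d) : (A i i).re ≤ A.trace.re := by
  rw [trace, Complex.re_sum]
  exact Finset.single_le_sum (f := fun i => (A.diag i).re)
    (fun j _ => (Complex.le_def.mp (hA.diag_nonneg (i := j))).1) (Finset.mem_univ i)

theorem Matrix.PosSemidef.diag_eq_one {d : Type*} [Fintype d] {A : Matrix d d ℂ}
    (hA : A.PosSemidef) (htr : A.trace = 1) {i : d} (h : 1 ≤ (A i i).re) : A i i = 1 := by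
  have h1 := hA.diag_re_le_trace i
  have h2 := (Complex.le_def.mp (hA.diag_nonneg (i := i))).2
  rw [htr, Complex.one_re] at h1
  refine Complex.ext (le_antisymm h1 h) ?_
  simpa using h2.symm

/-- The success probability averages 4 ^ n terms, each at most 1, so an average of 1 leaves no term
below 1. -/
theorem B84Protocol.outputState_diag_eq_one {ρ : DensityMatrix (R₁ × R₂)}
    (h : P.successProb ρ = 1) (q b : Bits n) : 1 ≤ (P.outputState ρ q b (b, b) (b, b)).re := by
  have hle : ∀ q b, (P.outputState ρ q b (b, b) (b, b)).re ≤ 1 := fun q b => by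
    have := (P.outputState_posSemidef ρ q b).diag_re_le_trace (b, b)
    rwa [P.trace_outputState, Complex.one_re] at this
  rw [B84Protocol.successProb, ← Fintype.sum_prod_type'] at h
  by_contra hlt
  push Not at hlt
  have hs : ∑ x : Bits n × Bits n, (P.outputState ρ x.1 x.2 (x.2, x.2) (x.2, x.2)).re
      < ∑ _x : Bits n × Bits n, (1 : ℝ) :=
    Finset.sum_lt_sum (fun x _ => hle x.1 x.2) ⟨(q, b), Finset.mem_univ _, hlt⟩
  have hc : ∑ _x : Bits n × Bits n, (1 : ℝ) = 4 ^ n := by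
    simp only [Finset.sum_const, Finset.card_univ, Fintype.card_prod, Fintype.card_pi,
      Fintype.card_fin, Finset.prod_const, nsmul_eq_mul, mul_one]
    push_cast
    rw [← mul_pow]
    norm_num
  rw [hc] at hs
  rw [one_div, inv_mul_eq_one₀ (by positivity)] at h
  exact absurd h hs.ne'

theorem B84Protocol.decode_fst {ρ : DensityMatrix (R₁ × R₂)} (h : P.successProb ρ = 1)
    (q b : Bits n) : kraus P.atR₁.K (partialTraceSnd (P.messageState ρ q b)) b b = 1 := by
  have hpos := P.outputState_posSemidef ρ q b
  rw [← partialTraceSnd_kraus P.atR₁.K P.atR₂.complete, ← P.outputState_eq]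
  refine (partialTraceSnd_posSemidef hpos).diag_eq_one
    ((trace_partialTraceSnd _).trans (P.trace_outputState ρ q b)) ?_
  refine (P.outputState_diag_eq_one h q b).trans ?_
  rw [partialTraceSnd, of_apply, Complex.re_sum]
  exact Finset.single_le_sum (f := fun k => (P.outputState ρ q b (b, k) (b, k)).re)
    (fun j _ => (Complex.le_def.mp (hpos.diag_nonneg (i := (b, j)))).1) (Finset.mem_univ b)

theorem B84Protocol.decode_snd {ρ : DensityMatrix (R₁ × R₂)} (h : P.successProb ρ = 1)
    (q b : Bits n) : kraus P.atR₂.K (partialTraceFst (P.messageState ρ q b)) b b = 1 := by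
  have hpos := P.outputState_posSemidef ρ q b
  rw [← partialTraceFst_kraus P.atR₁.complete P.atR₂.K, ← P.outputState_eq]
  refine (partialTraceFst_posSemidef hpos).diag_eq_one
    ((trace_partialTraceFst _).trans (P.trace_outputState ρ q b)) ?_
  refine (P.outputState_diag_eq_one h q b).trans ?_
  rw [partialTraceFst, of_apply, Complex.re_sum]
  exact Finset.single_le_sum (f := fun k => (P.outputState ρ q b (k, b) (k, b)).re)
    (fun j _ => (Complex.le_def.mp (hpos.diag_nonneg (i := (j, b)))).1) (Finset.mem_univ b)

theorem kraus_smul {a c : Type*} [Fintype a] {κ : Type*} [Fintype κ] (K : κ → Matrix c a ℂ) (z : ℂ)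
    (Y : Matrix a a ℂ) : kraus K (z • Y) = z • kraus K Y := by
  simp only [kraus, Matrix.mul_smul, Matrix.smul_mul, Finset.smul_sum]

/-- A protocol that succeeds with certainty needs mutual information at least `n / 2` bits. -/
theorem log_card_le_two_mul_matrixMutualInfo {ρ : DensityMatrix (R₁ × R₂)}
    (h : P.successProb ρ = 1) :
    Real.log (Fintype.card (Bits n)) ≤ 2 * matrixMutualInfo ρ.mat := by
  classical
  set w := (Fintype.card (Bits n) : ℂ)⁻¹ with hw
  -- The uniform weight of b is absorbed into the input vector, hence the square root.
  set c : ℂ := (((√(Fintype.card (Bits n) : ℝ))⁻¹ : ℝ) : ℂ) with hc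
  have hcc : c * star c = w := by
    rw [hc, hw, Complex.star_def, Complex.conj_ofReal, ← Complex.ofReal_mul, ← mul_inv,
      Real.mul_self_sqrt (Nat.cast_nonneg _)]
    simp
  have hnorm : ∀ q b : Bits n, ∑ x, star ((c • bb84Vec q b) x) * (c • bb84Vec q b) x = w := by
    intro q b
    have e : ∀ x, star ((c • bb84Vec q b) x) * (c • bb84Vec q b) x
        = (c * star c) * (star (bb84Vec q b x) * bb84Vec q b x) := fun x => by
      simp only [Pi.smul_apply, smul_eq_mul, star_mul']
      ring
    simp only [e]
    rw [← Finset.mul_sum, sum_star_bb84Vec_mul, if_pos rfl, hcc, mul_one]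
  have hket : ∀ q : Bits n, ∑ x, star (ket q x) * ket q x = (1 : ℂ) := fun q => by
    have := sum_star_bb84Vec_mul (fun _ => 0) q q
    simpa only [bb84Vec_zero, if_true] using this
  -- All qubits in the computational basis for r₁, all in the Hadamard basis for r₂.
  let q₀ : Bits n := fun _ => 0
  let q₁ : Bits n := fun _ => 1
  have side₁ := entropy_sub_le_of_decodable (ρ := ρ.mat)
    (L := fun b => slice (Equiv.refl _) P.atC₁.K (c • bb84Vec q₀ b))
    (Γ := slice (Equiv.refl _) P.atC₂.K (ket q₀)) (Δ := P.atR₁.K)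
    (fun b => by rw [slice_complete _ P.atC₁.complete, hnorm])
    (by rw [slice_complete _ P.atC₂.complete, hket, one_smul]) P.atR₁.complete ρ.posSemidef
    ρ.trace_eq_one (fun b => by
      have := P.decode_fst h q₀ b
      rw [partialTraceSnd_messageState] at this
      rw [show slice (Equiv.refl _) P.atC₁.K (c • bb84Vec q₀ b)
        = fun k => c • slice (Equiv.refl _) P.atC₁.K (bb84Vec q₀ b) k from
          funext fun k => slice_smul _ _ _ _ _, kraus_krausTensor_smul, hcc, kraus_smul,
        Matrix.smul_apply, this, smul_eq_mul, mul_one])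
  have side₂ := entropy_sub_le_of_decodable (ρ := ρ.mat)
    (L := fun b => slice (Equiv.prodComm _ _) P.atC₁.K (c • bb84Vec q₁ b))
    (Γ := slice (Equiv.prodComm _ _) P.atC₂.K (ket q₁)) (Δ := P.atR₂.K)
    (fun b => by rw [slice_complete _ P.atC₁.complete, hnorm])
    (by rw [slice_complete _ P.atC₂.complete, hket, one_smul]) P.atR₂.complete ρ.posSemidef
    ρ.trace_eq_one (fun b => by
      have := P.decode_snd h q₁ b
      rw [partialTraceFst_messageState] at this
      rw [show slice (Equiv.prodComm _ _) P.atC₁.K (c • bb84Vec q₁ b)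
        = fun k => c • slice (Equiv.prodComm _ _) P.atC₁.K (bb84Vec q₁ b) k from
          funext fun k => slice_smul _ _ _ _ _, kraus_krausTensor_smul, hcc, kraus_smul,
        Matrix.smul_apply, this, smul_eq_mul, mul_one])
  obtain ⟨B, hB⟩ := (partialTraceSnd_posSemidef ρ.posSemidef).exists_eq_mul_conjTranspose
  let t : Bits n → Bits n → P.atC₁.κ × R₁ → Fin P.m₁₁ → Fin P.m₁₂ → ℂ := fun q b k i j =>
    (P.atC₁.K k.1 * embed R₁ (c • bb84Vec q b) * B) (i, j) k.2
  have hfst : ∀ q b, reducedFst (t q b)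
      = kraus (slice (Equiv.refl _) P.atC₁.K (c • bb84Vec q b)) (partialTraceSnd ρ.mat) :=
    fun q b => by rw [hB]; exact reducedFst_eq_kraus_slice _ _ _
  have hsnd : ∀ q b, reducedSnd (t q b)
      = kraus (slice (Equiv.prodComm _ _) P.atC₁.K (c • bb84Vec q b)) (partialTraceSnd ρ.mat) :=
    fun q b => by rw [hB]; exact reducedSnd_eq_kraus_slice _ _ _
  -- Hadamard inputs are superpositions of computational ones. As `atC₁` does not depend on q, the
  -- output vectors t q₁ and t q₀ are related in the same way.
  have hexp : ∀ z, embed R₁ (c • bb84Vec q₁ z)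
      = ∑ x, bb84Vec q₁ z x • embed R₁ (c • bb84Vec q₀ x) := by
    intro z
    ext i j
    simp only [Matrix.sum_apply, Matrix.smul_apply, embed, of_apply, q₀, bb84Vec_zero, ket,
      Pi.smul_apply, smul_eq_mul, Pi.single_apply, mul_ite, mul_one, mul_zero]
    split_ifs
    · simp [mul_comm]
    · simp
  have hunc := log_card_le_entropy_add_entropy (t q₀) (t q₁) (fun z x => bb84Vec q₁ z x)
    (fun x y => by
      simp only [q₁, bb84Vec_one_symm _ x, bb84Vec_one_symm _ y]
      exact sum_star_bb84Vec_mul _ x y)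
    (fun z x => bb84Vec_one_mul_star z x)
    (fun z k i j => by
      simp only [t, hexp]
      rw [Matrix.mul_sum, Matrix.sum_mul, Matrix.sum_apply]
      simp only [Matrix.mul_smul, Matrix.smul_mul, Matrix.smul_apply, smul_eq_mul])
    (fun z => by
      rw [hsnd, trace_kraus_smul (w := w) (by rw [slice_complete _ P.atC₁.complete, hnorm]),
        trace_partialTraceSnd, ρ.trace_eq_one, mul_one])
  simp only [hfst, hsnd] at hunc
  linarith

end Protocol

end

/-! ### Comparison with the constant β -/

theorem theorem3 {R₁ R₂ : Type*} [Fintype R₁] [DecidableEq R₁] [Fintype R₂] [DecidableEq R₂]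
    (n : ℕ) (ρ : DensityMatrix (R₁ × R₂)) (hρ : SufficesForB84 n ρ 1) :
    (n : ℝ) * Real.logb 2 (1 / (1 / 2 + 1 / (2 * Real.sqrt 2))) - 1
      ≤ 1 / 2 * ρ.mutualInformation := by
  obtain ⟨P, hP⟩ := hρ
  have h := log_card_le_two_mul_matrixMutualInfo P hP
  have hcard : Real.log (Fintype.card (Bits n)) = n * Real.log 2 := by
    simp [Fintype.card_pi]
  rw [hcard] at h
  have hlog : 0 < Real.log 2 := Real.log_pos (by norm_num)
  have hI : (n : ℝ) / 4 ≤ 1 / 2 * ρ.mutualInformation := by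
    rw [ρ.mutualInformation_eq]
    have : (n : ℝ) ≤ 2 * matrixMutualInfo ρ.mat / Real.log 2 := by rwa [le_div_iff₀ hlog]
    rw [mul_div_assoc] at this
    linarith
  -- It suffices that β⁴ ≥ 1/2. The rational bound 17/20 ≤ β is enough, since (17/20)⁴ ≈ 0.522.
  have hβ : Real.logb 2 (1 / (1 / 2 + 1 / (2 * Real.sqrt 2))) ≤ 1 / 4 := by
    set β : ℝ := 1 / 2 + 1 / (2 * Real.sqrt 2) with hβ
    have h85 : (17 / 20 : ℝ) ≤ β := by
      have hs : Real.sqrt 2 ≤ 10 / 7 := by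
        rw [Real.sqrt_le_left (by norm_num)]
        norm_num
      have : (7 / 20 : ℝ) ≤ 1 / (2 * Real.sqrt 2) := by
        rw [le_div_iff₀ (by positivity)]
        linarith
      rw [hβ]
      linarith
    have hβ0 : 0 < β := by linarith
    have h4 : (1 / β) ^ 4 ≤ 2 := by
      rw [div_pow, one_pow, div_le_iff₀ (by positivity)]
      have := pow_le_pow_left₀ (by norm_num) h85 4
      norm_num at this
      linarith
    have hl := Real.log_le_log (by positivity) h4
    rw [Real.log_pow] at hl
    rw [Real.logb, div_le_iff₀ hlog]
    push_cast at hl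
    linarith
  have := mul_le_mul_of_nonneg_left hβ (Nat.cast_nonneg n : (0 : ℝ) ≤ n)
  linarith
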